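/- **Setting.** Let $\Sigma=\{1,\dots,N\}$ with $N\ge1$, $A_i\in\mathbb R^{d\times d}$, $B_i\in\mathbb R^{d\times c}$ for $i\in\Sigma$, and let $K\subseteq\mathbb R^d$ be compact with $0\in\operatorname{int}K$. Consider the switched linear system $$\dot x(t)=A_{\sigma(t)}x(t)+B_{\sigma(t)}u(t),\qquad x(0)\in K,\quad t\ge0,$$ where a *switching signal* $\sigma:\mathbb R_{\ge0}\to\Sigma$ is a right-continuous, piecewise constant function (finitely many discontinuities in every bounded interval), $N_\sigma(t,s)$ denotes the number of its discontinuities in $[s,t)$, and solutions are understood in the sense of Carathéodory. Norms are Euclidean norms and the induced matrix norms. Let $\tau_a>0$. For $N_0\ge0$ say that $\sigma$ has average dwell time $\tau_a$ with constant $N_0$ if $N_\sigma(t,s)\le N_0+\frac{t-s}{\tau_a}$ for all $t\ge s\ge0$. A *coder–controller with sampling period* $\tau_s>0$ consists of finite alphabets $\mathcal E_k$, coder functions $\gamma_k:(\mathbb R^d)^{k+1}\times\Sigma^{k+1}\to\mathcal E_k$, and controller functions $\zeta_k$ mapping $\mathcal E_0\times\dots\times\mathcal E_k$ to integrable functions $[T_k,T_{k+1})\to\mathbb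 R^c$, where $T_k=k\tau_s$ and $k\in\mathbb N$. It is applied by $e_k=\gamma_k(x(T_0),\dots,x(T_k);\sigma(T_0),\dots,\sigma(T_k))$ and $u|_{[T_k,T_{k+1})}=\zeta_k(e_0,\dots,e_k)$. Its data rate is $R=\limsup_{k\to\infty}\frac1{k\tau_s}\sum_{j<k}\log_2|\mathcal E_j|$. It *stabilizes* the system if there is $\lambda>0$ such that for every $N_0\ge0$ there is a class-$\mathcal K$ function $g$ (strictly increasing, continuous, $g:\mathbb R_{\ge0}\to\mathbb R_{\ge0}$, $g(0)=0$) such that, for every switching signal $\sigma$ with average dwell time $\tau_a$ with constant $N_0$, every trajectory with $x(0)\in K$ of the system with the input so generated satisfies $$\|x(t)\|\le g(\|x(0)\|)\,e^{-\lambda t}\qquad\text{for all }t\ge0.$$ **Assumption.** There are $\varphi:\mathbb R^d\times\Sigma\to\mathbb R^c$, positively homogeneous and piecewise continuous in the first argument (finitely many locally closed pieces cover $\mathbb R^d$, and on each of them $\varphi(\cdot,i)$ is continuous and extends continuously to the closure), and constants $D\ge0$, $\mu_1,\mu_2>0$ with $\mu_1/\tau_a<\mu_2$, such that for every switching signal $\sigma$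 (without any dwell-time restriction) and every initial state, the closed loop $\dot x=A_\sigma x+B_\sigma\varphi(x,\sigma)$ has a solution on $[0,\infty)$, and every solution satisfies $\|x(t)\|\le D\|x(0)\|e^{\mu_1N_\sigma(t,0)-\mu_2t}$ for all $t\ge0$. **Theorem.** Under this assumption: 1. There is a coder–controller with finite data rate $R<\infty$ that stabilizes the system. 2. Put $\nu=\frac12\max_i\lambda_{\max}(A_i+A_i^\top)$, $\Delta_1=\max_{i,j}\|A_i-A_j\|$, $\Delta_2=\max_{i,j}\|B_i-B_j\|$, $L=\sup\{\|\varphi(\xi,i)\|:\|\xi\|=1,\ i\in\Sigma\}$. There exist $\tau_s>0$, $\alpha>0$ and an integer $n\ge1$ with $$De^{-\mu_2n\tau_s}+e^{\nu n\tau_s}\alpha+e^{\nu n\tau_s}\tau_s\frac{n\tau_s}{\tau_a}D(\Delta_1+\Delta_2L)<e^{-\mu_1n\tau_s/\tau_a},\qquad(*)$$ and for all $\tau_s>0$, $\alpha>0$, $n\ge1$ that satisfy $(*)$ there is a coder–controller with sampling period $\tau_s$ that stabilizes the system and has data rate $$R=\frac1{\tau_s}\Big[\frac1n\log_2\hat m_\alpha+\frac1n\log_2(n+1)+\log_2N\Big],\qquad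 \hat m_\alpha=\Big(2\Big\llbracket\frac{\sqrt d}{2\alpha}\Big\rrbracket+1\Big)^d,$$ where $\llbracket\cdot\rrbracket$ is rounding to the nearest integer (half-integers are rounded up). -/

import Mathlib

open MeasureTheory Filter Topology Set

noncomputable section

/-- `σ` (only its values on `[0, ∞)` matter) is a switching signal: right-continuous and
piecewise constant, i.e. with finitely many discontinuities in every bounded interval.
The mode set `Fin N` carries the discrete topology. -/
structure IsSwitchingSignal {N : ℕ} (σ : ℝ → Fin N) : Prop where
  rightCont : ∀ t : ℝ, 0 ≤ t → ContinuousWithinAt σ (Ici t) t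
  finite_switches :
    ∀ T : ℝ, {s : ℝ | s ∈ Ico 0 T ∧ ¬ ContinuousWithinAt σ (Ici 0) s}.Finite

/-- `numSwitches σ t s`: the number of discontinuity points in `[s, t)` of `σ`, seen as a
function on `[0, ∞)`. -/
def numSwitches {N : ℕ} (σ : ℝ → Fin N) (t s : ℝ) : ℕ :=
  {r : ℝ | r ∈ Ico s t ∧ ¬ ContinuousWithinAt σ (Ici 0) r}.ncard

/-- Average dwell time `τa` with chatter bound `N₀`. -/
def HasADT {N : ℕ} (σ : ℝ → Fin N) (τa N₀ : ℝ) : Prop :=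
  ∀ s t : ℝ, 0 ≤ s → s ≤ t → (numSwitches σ t s : ℝ) ≤ N₀ + (t - s) / τa

/-- The right-hand side `M x + P v`. -/
def affineField {d c : ℕ} (M : Matrix (Fin d) (Fin d) ℝ) (P : Matrix (Fin d) (Fin c) ℝ)
    (x : EuclideanSpace ℝ (Fin d)) (v : EuclideanSpace ℝ (Fin c)) : EuclideanSpace ℝ (Fin d) :=
  WithLp.toLp 2 (M.mulVec x.ofLp + P.mulVec v.ofLp)

/-- `x` is a (Carathéodory) solution on `[0, ∞)` of `x' = A_σ x + B_σ u`: the right-hand side is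
locally integrable along `x` and `x` is its primitive. -/
def IsSolution {d c N : ℕ} (A : Fin N → Matrix (Fin d) (Fin d) ℝ)
    (B : Fin N → Matrix (Fin d) (Fin c) ℝ) (σ : ℝ → Fin N)
    (u : ℝ → EuclideanSpace ℝ (Fin c)) (x : ℝ → EuclideanSpace ℝ (Fin d)) : Prop :=
  ∀ t : ℝ, 0 ≤ t →
    IntervalIntegrable (fun s => affineField (A (σ s)) (B (σ s)) (x s) (u s)) volume 0 t ∧
    x t = x 0 + ∫ s in (0 : ℝ)..t, affineField (A (σ s)) (B (σ s)) (x s) (u s)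

/-- Piecewise continuity: the space is covered by finitely many locally closed pieces, and on each
piece `f` is continuous and extends continuously to the closure of the piece. -/
def IsPiecewiseContinuous {E F : Type*} [TopologicalSpace E] [TopologicalSpace F]
    (f : E → F) : Prop :=
  ∃ (m : ℕ) (P : Fin m → Set E), (⋃ j, P j) = univ ∧
    ∀ j, IsLocallyClosed (P j) ∧
      ∃ g : E → F, ContinuousOn g (closure (P j)) ∧ EqOn f g (P j)

/-- The feedback law `φ` stabilizes the switched system without data-rate constraints:
`φ` is positively homogeneous and piecewise continuous in the state, and for every switching signal
and every initial state the closed loop has a solution, and every solution satisfies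
`‖x t‖ ≤ D ‖x 0‖ exp (μ₁ N_σ(t,0) - μ₂ t)`. -/
structure IsStabilizingFeedback {d c N : ℕ} (A : Fin N → Matrix (Fin d) (Fin d) ℝ)
    (B : Fin N → Matrix (Fin d) (Fin c) ℝ)
    (φ : EuclideanSpace ℝ (Fin d) → Fin N → EuclideanSpace ℝ (Fin c))
    (D μ₁ μ₂ : ℝ) : Prop where
  homogeneous : ∀ (a : ℝ) (ξ : EuclideanSpace ℝ (Fin d)) (i : Fin N), 0 < a →
    φ (a • ξ) i = a • φ ξ i
  piecewiseContinuous : ∀ i : Fin N, IsPiecewiseContinuous (fun ξ => φ ξ i)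
  exists_solution : ∀ σ : ℝ → Fin N, IsSwitchingSignal σ → ∀ x₀ : EuclideanSpace ℝ (Fin d),
    ∃ x : ℝ → EuclideanSpace ℝ (Fin d), x 0 = x₀ ∧
      IsSolution A B σ (fun t => φ (x t) (σ t)) x
  bound : ∀ σ : ℝ → Fin N, IsSwitchingSignal σ → ∀ x : ℝ → EuclideanSpace ℝ (Fin d),
    IsSolution A B σ (fun t => φ (x t) (σ t)) x → ∀ t : ℝ, 0 ≤ t →
      ‖x t‖ ≤ D * ‖x 0‖ * Real.exp (μ₁ * (numSwitches σ t 0 : ℝ) - μ₂ * t)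

/-- A coder–controller with sampling period `τs`: finite alphabets, coder functions of the sampled
states and modes up to `T_k = k τs`, and controller functions of the symbols received up to `T_k`,
whose value is an input on `[T_k, T_{k+1})` (values outside this interval are irrelevant). -/
structure CoderController (d c N : ℕ) (τs : ℝ) where
  Alphabet : ℕ → Type
  fintypeAlphabet : ∀ k, Fintype (Alphabet k)
  coder : ∀ k : ℕ, (Fin (k + 1) → EuclideanSpace ℝ (Fin d)) → (Fin (k + 1) → Fin N) → Alphabet k
  controller : ∀ k : ℕ, (∀ j : Fin (k + 1), Alphabet j) → ℝ → EuclideanSpace ℝ (Fin c)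
  integrable : ∀ (k : ℕ) (e : ∀ j : Fin (k + 1), Alphabet j),
    IntegrableOn (controller k e) (Ico ((k : ℝ) * τs) (((k : ℝ) + 1) * τs)) volume

namespace CoderController

variable {d c N : ℕ} {τs : ℝ}

/-- Averaged data rate in bits per unit of time. -/
def dataRate (C : CoderController d c N τs) : EReal :=
  limsup (fun k : ℕ =>
    (((1 / ((k : ℝ) * τs)) * ∑ j ∈ Finset.range k,
      Real.logb 2 (@Fintype.card (C.Alphabet j) (C.fintypeAlphabet j) : ℝ) : ℝ) : EReal)) atTop

/-- The symbol sent at time `T_k` along `(x, σ)`. -/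
def symbol (C : CoderController d c N τs) (x : ℝ → EuclideanSpace ℝ (Fin d)) (σ : ℝ → Fin N)
    (k : ℕ) : C.Alphabet k :=
  C.coder k (fun j => x ((j : ℕ) * τs)) (fun j => σ ((j : ℕ) * τs))

/-- `x` is a trajectory, under the switching signal `σ`, of the system in closed loop with `C`. -/
def IsTrajectory (C : CoderController d c N τs) (A : Fin N → Matrix (Fin d) (Fin d) ℝ)
    (B : Fin N → Matrix (Fin d) (Fin c) ℝ) (σ : ℝ → Fin N)
    (x : ℝ → EuclideanSpace ℝ (Fin d)) : Prop :=
  ∃ u : ℝ → EuclideanSpace ℝ (Fin c),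
    (∀ k : ℕ, EqOn u (C.controller k (fun j => C.symbol x σ j))
      (Ico ((k : ℝ) * τs) (((k : ℝ) + 1) * τs))) ∧
    IsSolution A B σ u x

end CoderController

/-- Class-`K` functions. -/
def IsClassK (g : NNReal → NNReal) : Prop := StrictMono g ∧ Continuous g ∧ g 0 = 0

/-- `C` stabilizes the system with initial states in `K` and average dwell time `τa`. The
coder–controller and the decay rate `lam` do not depend on the constant `N₀`. -/
def Stabilizes {d c N : ℕ} {τs : ℝ} (C : CoderController d c N τs)
    (A : Fin N → Matrix (Fin d) (Fin d) ℝ) (B : Fin N → Matrix (Fin d) (Fin c) ℝ)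
    (K : Set (EuclideanSpace ℝ (Fin d))) (τa : ℝ) : Prop :=
  ∃ lam : ℝ, 0 < lam ∧ ∀ N₀ : ℝ, 0 ≤ N₀ → ∃ g : NNReal → NNReal, IsClassK g ∧
    ∀ σ : ℝ → Fin N, IsSwitchingSignal σ → HasADT σ τa N₀ →
      ∀ x : ℝ → EuclideanSpace ℝ (Fin d), x 0 ∈ K → C.IsTrajectory A B σ x →
        ∀ t : ℝ, 0 ≤ t → ‖x t‖ ≤ (g ‖x 0‖₊ : ℝ) * Real.exp (-lam * t)

/-- `ν = ½ max_i λ_max (A_i + A_iᵀ)`. -/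
def growthRate {d N : ℕ} (A : Fin N → Matrix (Fin d) (Fin d) ℝ) : ℝ :=
  (1 / 2) * ⨆ i, sSup (spectrum ℝ (A i + (A i).transpose))

open scoped Matrix.Norms.L2Operator in
/-- `max_{i,j} ‖M_i - M_j‖` for the operator norm induced by the Euclidean norms. -/
def modeSpread {p q N : ℕ} (M : Fin N → Matrix (Fin p) (Fin q) ℝ) : ℝ :=
  ⨆ ij : Fin N × Fin N, ‖M ij.1 - M ij.2‖

/-- `L`, the supremum of `‖φ(ξ, i)‖` over the unit sphere and all modes. -/
def feedbackGain {d c N : ℕ}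
    (φ : EuclideanSpace ℝ (Fin d) → Fin N → EuclideanSpace ℝ (Fin c)) : ℝ :=
  sSup {r : ℝ | ∃ (ξ : EuclideanSpace ℝ (Fin d)) (i : Fin N), ‖ξ‖ = 1 ∧ r = ‖φ ξ i‖}

/-- The requirement on the design parameters `τs`, `α`, `n`. -/
structure AdmissibleParameters {d c N : ℕ} (A : Fin N → Matrix (Fin d) (Fin d) ℝ)
    (B : Fin N → Matrix (Fin d) (Fin c) ℝ)
    (φ : EuclideanSpace ℝ (Fin d) → Fin N → EuclideanSpace ℝ (Fin c))
    (D μ₁ μ₂ τa τs α : ℝ) (n : ℕ) : Prop where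
  period_pos : 0 < τs
  accuracy_pos : 0 < α
  one_le : 1 ≤ n
  lt : D * Real.exp (-μ₂ * (n * τs)) + Real.exp (growthRate A * (n * τs)) * α
      + Real.exp (growthRate A * (n * τs)) * τs * ((n * τs) / τa) * D
        * (modeSpread A + modeSpread B * feedbackGain φ)
    < Real.exp (-μ₁ * (n * τs) / τa)

/-- `(2 ⟦√d / (2 α)⟧ + 1) ^ d`, with `⟦·⟧` rounding to the nearest integer. -/
def quantizerSize (d : ℕ) (α : ℝ) : ℝ :=
  (2 * (round (Real.sqrt d / (2 * α)) : ℝ) + 1) ^ d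

/-- The data rate of the coder–controller with parameters `τs`, `α`, `n`. -/
def designRate (d N : ℕ) (τs α : ℝ) (n : ℕ) : ℝ :=
  (1 / τs) * ((1 / n) * Real.logb 2 (quantizerSize d α) + (1 / n) * Real.logb 2 ((n : ℝ) + 1)
    + Real.logb 2 (N : ℝ))

end

/-! Time is cut into blocks of `n` sampling intervals, of length T = nτ. At every sampling time the
coder sends the current mode. At the start of a block it also sends a quantization cell of the
state, relative to a bound ρ known to coder and controller, and an index p ≤ n that updates ρ. The
controller simulates the closed loop from the quantized state z with the sampled modes and applies
the feedback along this simulation.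

The simulation is a genuine closed-loop solution for a piecewise constant signal, so the assumed
decay applies to it (`norm_stepSol_le`). The true state deviates by the quantization error αρ,
amplified by e^{νT}, plus a mismatch term for each sampling window in which σ switches. With p such
windows the state at the end of the block is at most ρ e^{μ₁p}(a + bp) (`norm_sample_succ_le`). The
coder sees that state, so it can send the least sufficient index, which is at most p.

Over J blocks the indices sum to at most N₀ + 1 + Js with s = T/τa. Since 1 + x ≤ e^x, the product
of the factors is at most a constant times q^J with q = e^{μ₁s}(a + bs) (`prod_exp_mul_affine_le`),
and (*) says exactly that q < 1. Only the constant depends on N₀.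

This bound does not tend to zero with x(0), because ρ starts at a fixed radius. But ρ shrinks at
most by e^{νT}α per block, so a very small initial state is quantized to zero for many blocks.
Meanwhile no input acts and the growth is at most e^{νt} (`norm_le_exp_of_small`). Interpolating the
two bounds yields the class-K function (`exists_isClassK_of_exp_bounds`). All this needs ν ≥ 0; for
ν < 0 the zero input suffices, with the same alphabets. -/

/-! ### Grönwall estimate for absolutely continuous curves. -/

/-- A continuous function whose increments are dominated by those of the primitive of a continuous
function `G` has upper right slopes at most `G`. -/
theorem frequently_slope_lt_of_sub_le_integral {y G : ℝ → ℝ} {T : ℝ}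
    (hG : ContinuousOn G (Icc 0 T))
    (h : ∀ a b, 0 ≤ a → a ≤ b → b ≤ T → y b - y a ≤ ∫ s in a..b, G s) :
    ∀ a ∈ Ico 0 T, ∀ r, G a < r → ∃ᶠ z in 𝓝[>] a, slope y a z < r := by
  intro a ha r hr
  obtain ⟨r', hr', hr''⟩ := exists_between hr
  have hnear : ∀ᶠ z in 𝓝[≥] a, G z < r' := by
    have hc : ContinuousWithinAt G (Icc a T) a :=
      (hG a ⟨ha.1, ha.2.le⟩).mono (Icc_subset_Icc_left ha.1)
    have hc' : Tendsto G (𝓝[≥] a) (𝓝 (G a)) := by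
      have := hc.tendsto
      rwa [nhdsWithin_Icc_eq_nhdsGE ha.2] at this
    exact hc'.eventually_lt_const hr'
  obtain ⟨b, hab, hb⟩ := (mem_nhdsGE_iff_exists_Ico_subset).1 hnear
  have hev : ∀ᶠ z in 𝓝[>] a, slope y a z < r := by
    filter_upwards [Ioo_mem_nhdsGT (show a < min b T from lt_min hab ha.2)] with z hz
    have hzb : z < b := hz.2.trans_le (min_le_left _ _)
    have hzT : z < T := hz.2.trans_le (min_le_right _ _)
    have hint : IntervalIntegrable G volume a z :=
      (hG.mono (Icc_subset_Icc ha.1 hzT.le)).intervalIntegrable_of_Icc hz.1.le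
    have h1 : ∫ s in a..z, G s ≤ ∫ _ in a..z, r' :=
      intervalIntegral.integral_mono_on hz.1.le hint (by simp)
        (fun s hs => (hb ⟨hs.1, hs.2.trans_lt hzb⟩ : G s < r').le)
    have h2 := h a z ha.1 hz.1.le hzT.le
    rw [intervalIntegral.integral_const, smul_eq_mul] at h1
    have hpos : 0 < z - a := sub_pos.2 hz.1
    rw [slope_def_field, div_lt_iff₀ hpos]
    nlinarith
  exact hev.frequently

theorem AbsolutelyContinuousOnInterval.finset_sum {ι : Type*} (s : Finset ι) {F : ι → ℝ → ℝ}
    {a b : ℝ} (h : ∀ i ∈ s, AbsolutelyContinuousOnInterval (F i) a b) :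
    AbsolutelyContinuousOnInterval (fun t => ∑ i ∈ s, F i t) a b := by
  classical
  induction s using Finset.induction_on with
  | empty =>
    simp only [Finset.sum_empty]
    exact contDiffOn_const.absolutelyContinuousOnInterval
  | insert i s hi ih =>
    simp only [Finset.sum_insert hi]
    exact (h i (Finset.mem_insert_self i s)).add (ih fun j hj => h j (Finset.mem_insert_of_mem hj))

/-- Each coordinate is a primitive of an integrable function, and squares and finite sums preserve
absolute continuity. -/
theorem absolutelyContinuousOnInterval_norm_sq {d : ℕ} {e f : ℝ → EuclideanSpace ℝ (Fin d)} {T : ℝ}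
    (hT : 0 ≤ T) (hf : IntervalIntegrable f volume 0 T)
    (he : ∀ t ∈ Icc 0 T, e t = e 0 + ∫ s in (0 : ℝ)..t, f s) :
    AbsolutelyContinuousOnInterval (fun t => ‖e t‖ ^ 2) 0 T := by
  have hcoord : ∀ i, AbsolutelyContinuousOnInterval (fun t => e t i) 0 T := by
    intro i
    have hfi : IntervalIntegrable (fun s => f s i) volume 0 T :=
      ⟨(EuclideanSpace.proj (𝕜 := ℝ) i).integrable_comp hf.1,
        (EuclideanSpace.proj (𝕜 := ℝ) i).integrable_comp hf.2⟩
    have h1 := hfi.absolutelyContinuousOnInterval_intervalIntegral (c := 0) left_mem_uIcc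
    have h2 : AbsolutelyContinuousOnInterval (fun _ : ℝ => e 0 i) 0 T :=
      contDiffOn_const.absolutelyContinuousOnInterval
    have h3 := h2.add h1
    -- The formula for `e` holds only on [0, T]. The ε–δ form evaluates functions only at points of
    -- that interval, so it transfers.
    rw [absolutelyContinuousOnInterval_iff] at h3 ⊢
    have heq : ∀ t ∈ Icc 0 T, e t i = e 0 i + ∫ s in (0 : ℝ)..t, f s i := by
      intro t ht
      have hft : IntervalIntegrable f volume 0 t :=
        hf.mono_set (by rw [uIcc_of_le ht.1, uIcc_of_le hT]; exact Icc_subset_Icc_right ht.2)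
      rw [he t ht]
      have := (EuclideanSpace.proj (𝕜 := ℝ) i).intervalIntegral_comp_comm hft
      rw [PiLp.add_apply]
      exact congrArg _ this.symm
    intro ε hε
    obtain ⟨δ, hδ, h⟩ := h3 ε hε
    refine ⟨δ, hδ, fun E hE hlen => ?_⟩
    have := h E hE hlen
    convert! this using 3 with j hj j hj
    all_goals
      have hj' := hE.1 j hj
      rw [uIcc_of_le hT] at hj'
    · exact heq _ hj'.1
    · exact heq _ hj'.2
  have := AbsolutelyContinuousOnInterval.finset_sum (Finset.univ : Finset (Fin d))
    (fun i _ => (hcoord i).fun_mul (hcoord i))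
  convert! this using 2 with t
  rw [EuclideanSpace.real_norm_sq_eq]
  simp [sq]

/-- Grönwall's estimate for absolutely continuous functions whose derivative `f` satisfies
`⟪e, f⟫ ≤ ν ‖e‖² + W ‖e‖`. -/
theorem norm_le_of_inner_le {d : ℕ} {e f : ℝ → EuclideanSpace ℝ (Fin d)} {T ν W : ℝ}
    (hf : IntervalIntegrable f volume 0 T)
    (he : ∀ t ∈ Icc 0 T, e t = e 0 + ∫ s in (0 : ℝ)..t, f s)
    (h : ∀ s ∈ Ioo 0 T, inner ℝ (e s) (f s) ≤ ν * ‖e s‖ ^ 2 + ‖e s‖ * W)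
    (hW : 0 ≤ W) (hν : 0 ≤ ν ∨ W = 0) :
    ∀ t ∈ Icc 0 T, ‖e t‖ ≤ Real.exp (ν * t) * (‖e 0‖ + t * W) := by
  rcases lt_or_ge T 0 with hT | hT
  · intro t ht; exact absurd (ht.1.trans ht.2) (not_le.2 hT)
  -- The squared norm is used because the norm is not differentiable at zeros of `e`.
  set y : ℝ → ℝ := fun t => ‖e t‖ ^ 2 with hy
  set G : ℝ → ℝ := fun t => 2 * (ν * ‖e t‖ ^ 2 + ‖e t‖ * W) with hGdef
  have hac := absolutelyContinuousOnInterval_norm_sq hT hf he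
  have hyc : ContinuousOn y (Icc 0 T) := by
    have := hac.continuousOn
    rwa [uIcc_of_le hT] at this
  have hnc : ContinuousOn (fun t => ‖e t‖) (Icc 0 T) := by
    have : ContinuousOn (fun t => Real.sqrt (y t)) (Icc 0 T) := hyc.sqrt
    refine this.congr fun t _ => ?_
    simp [hy, Real.sqrt_sq]
  have hGc : ContinuousOn G (Icc 0 T) := by
    simp only [hGdef]
    fun_prop
  have hincr : ∀ a b, 0 ≤ a → a ≤ b → b ≤ T → y b - y a ≤ ∫ s in a..b, G s := by
    intro a b ha hab hb
    have hac' : AbsolutelyContinuousOnInterval y a b :=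
      hac.mono (by rw [uIcc_of_le hab, uIcc_of_le hT]; exact Icc_subset_Icc ha hb)
    rw [← hac'.integral_deriv_eq_sub]
    refine intervalIntegral.integral_mono_ae_restrict hab hac'.intervalIntegrable_deriv
      ((hGc.mono (Icc_subset_Icc ha hb)).intervalIntegrable_of_Icc hab) ?_
    have hne : ∀ᵐ s : ℝ, s ≠ 0 ∧ s ≠ T := by
      have h1 : ∀ᵐ s : ℝ, s ≠ 0 := by simp [ae_iff]
      have h2 : ∀ᵐ s : ℝ, s ≠ T := by simp [ae_iff]
      filter_upwards [h1, h2] with s h1 h2 using ⟨h1, h2⟩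
    refine (ae_restrict_iff' measurableSet_Icc).2 ?_
    filter_upwards [hf.ae_hasDerivAt_integral, hne] with s hs hne hsab
    have hs0 : s ∈ Ioo 0 T :=
      ⟨lt_of_le_of_ne (ha.trans hsab.1) (Ne.symm hne.1), lt_of_le_of_ne (hsab.2.trans hb) hne.2⟩
    have hd := hs (by rw [uIcc_of_le hT]; exact ⟨hs0.1.le, hs0.2.le⟩) 0 left_mem_uIcc
    have hde : HasDerivAt e (f s) s := by
      refine (hd.const_add (e 0)).congr_of_eventuallyEq ?_
      filter_upwards [Ioo_mem_nhds hs0.1 hs0.2] with t ht using he t ⟨ht.1.le, ht.2.le⟩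
    rw [hde.norm_sq.deriv]
    have := h s hs0
    simp only [hGdef]
    linarith
  have hslope := frequently_slope_lt_of_sub_le_integral hGc hincr
  -- The comparison theorem needs a strict inequality of derivatives wherever the curves touch. The
  -- slack η provides it and keeps the barrier positive; it tends to 0 at the end.
  have key : ∀ η : ℝ, 0 < η → ∀ t ∈ Icc 0 T,
      ‖e t‖ ≤ Real.exp (ν * t) * (‖e 0‖ + η + t * (W + η)) := by
    intro η hη
    set b : ℝ → ℝ := fun t => Real.exp (ν * t) * (‖e 0‖ + η + t * (W + η)) with hb
    have hbd : ∀ t, HasDerivAt b (ν * b t + Real.exp (ν * t) * (W + η)) t := by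
      intro t
      have h1 : HasDerivAt (fun t => Real.exp (ν * t)) (Real.exp (ν * t) * ν) t := by
        simpa using ((hasDerivAt_id t).const_mul ν).exp
      have h2 : HasDerivAt (fun t => ‖e 0‖ + η + t * (W + η)) (W + η) t := by
        simpa using ((hasDerivAt_id t).mul_const (W + η)).const_add (‖e 0‖ + η)
      refine (h1.mul h2).congr_deriv ?_
      simp only [hb]; ring
    have hbpos : ∀ t, 0 ≤ t → 0 < b t := fun t ht => by
      change 0 < Real.exp (ν * t) * (‖e 0‖ + η + t * (W + η))
      positivity
    have hle : ∀ ⦃t⦄, t ∈ Icc 0 T → y t ≤ (b t) ^ 2 := by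
      refine image_le_of_liminf_slope_right_lt_deriv_boundary (f' := G)
        (B' := fun t => 2 * b t * (ν * b t + Real.exp (ν * t) * (W + η))) hyc hslope ?_ ?_ ?_
      · change ‖e 0‖ ^ 2 ≤ (Real.exp (ν * 0) * (‖e 0‖ + η + 0 * (W + η))) ^ 2
        have := norm_nonneg (e 0)
        rw [mul_zero, Real.exp_zero, zero_mul, add_zero, one_mul]
        gcongr
        linarith
      · intro t
        simpa using (hbd t).fun_pow 2
      · intro t ht heq
        have hbt := hbpos t ht.1
        have hne : ‖e t‖ = b t := by
          have : ‖e t‖ ^ 2 = (b t) ^ 2 := heq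
          exact (pow_left_inj₀ (norm_nonneg _) hbt.le two_ne_zero).1 this
        have hlt : W < Real.exp (ν * t) * (W + η) := by
          rcases hν with h0 | h0
          · have h1 : 1 ≤ Real.exp (ν * t) := Real.one_le_exp (mul_nonneg h0 ht.1)
            nlinarith
          · rw [h0]; positivity
        simp only [hGdef, hne]
        nlinarith
    intro t ht
    exact (pow_le_pow_iff_left₀ (norm_nonneg _) (hbpos t ht.1).le two_ne_zero).1 (hle ht)
  intro t ht
  have hlim : Tendsto (fun η : ℝ => Real.exp (ν * t) * (‖e 0‖ + η + t * (W + η))) (𝓝[>] 0)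
      (𝓝 (Real.exp (ν * t) * (‖e 0‖ + 0 + t * (W + 0)))) :=
    tendsto_nhdsWithin_of_tendsto_nhds (Continuous.tendsto (by fun_prop) 0)
  simp only [add_zero] at hlim
  refine ge_of_tendsto hlim ?_
  filter_upwards [self_mem_nhdsWithin] with η hη using key η hη t ht

/-! ### Growth rate and mode mismatch of the vector fields. -/

theorem Matrix.IsHermitian.dotProduct_mulVec_le_sSup_spectrum {d : ℕ}
    {S : Matrix (Fin d) (Fin d) ℝ} (hS : S.IsHermitian) (x : Fin d → ℝ) :
    x ⬝ᵥ S.mulVec x ≤ sSup (spectrum ℝ S) * (x ⬝ᵥ x) := by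
  have hbdd : BddAbove (spectrum ℝ S) := by
    rw [hS.spectrum_real_eq_range_eigenvalues]
    exact (finite_range _).bddAbove
  have hps : (algebraMap ℝ _ (sSup (spectrum ℝ S)) - S).PosSemidef := by
    rw [Matrix.posSemidef_iff_isHermitian_and_spectrum_nonneg]
    refine ⟨?_, ?_⟩
    · refine Matrix.IsHermitian.sub ?_ hS
      rw [Matrix.algebraMap_eq_diagonal]
      exact Matrix.isHermitian_diagonal _
    · rw [← spectrum.singleton_sub_eq]
      rintro _ ⟨a, rfl, b, hb, rfl⟩
      exact sub_nonneg.2 (le_csSup hbdd hb)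
  have h := hps.dotProduct_mulVec_nonneg x
  rw [Matrix.sub_mulVec, dotProduct_sub, Algebra.algebraMap_eq_smul_one, Matrix.smul_mulVec,
    Matrix.one_mulVec, dotProduct_smul, smul_eq_mul] at h
  simpa using h

/-- Only the symmetric part of `A i` contributes to the quadratic form; hence the rate is ν and not
an operator norm. -/
theorem inner_mulVec_le_growthRate {d N : ℕ} (A : Fin N → Matrix (Fin d) (Fin d) ℝ) (i : Fin N)
    (x : EuclideanSpace ℝ (Fin d)) :
    inner ℝ x (WithLp.toLp 2 ((A i).mulVec x.ofLp)) ≤ growthRate A * ‖x‖ ^ 2 := by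
  have hS : (A i + (A i).transpose).IsHermitian := by
    simpa using Matrix.isHermitian_add_transpose_self (A i)
  have h1 := hS.dotProduct_mulVec_le_sSup_spectrum x.ofLp
  have h2 : sSup (spectrum ℝ (A i + (A i).transpose))
      ≤ ⨆ j, sSup (spectrum ℝ (A j + (A j).transpose)) :=
    le_ciSup (f := fun j => sSup (spectrum ℝ (A j + (A j).transpose))) (finite_range _).bddAbove i
  have h3 : x.ofLp ⬝ᵥ (A i).transpose.mulVec x.ofLp = x.ofLp ⬝ᵥ (A i).mulVec x.ofLp := by
    rw [Matrix.mulVec_transpose, dotProduct_comm, ← Matrix.dotProduct_mulVec]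
  have h4 : inner ℝ x (WithLp.toLp 2 ((A i).mulVec x.ofLp)) = x.ofLp ⬝ᵥ (A i).mulVec x.ofLp := by
    rw [EuclideanSpace.inner_eq_star_dotProduct]
    simp [dotProduct_comm]
  have h5 : ‖x‖ ^ 2 = x.ofLp ⬝ᵥ x.ofLp := by
    rw [EuclideanSpace.real_norm_sq_eq]
    simp [dotProduct, sq]
  rw [Matrix.add_mulVec, dotProduct_add, h3, ← h5] at h1
  rw [h4, growthRate]
  have h6 := mul_le_mul_of_nonneg_right h2 (sq_nonneg ‖x‖)
  linarith

open scoped Matrix.Norms.L2Operator in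
theorem norm_sub_mulVec_le_modeSpread {p q N : ℕ} (M : Fin N → Matrix (Fin p) (Fin q) ℝ)
    (i j : Fin N) (v : EuclideanSpace ℝ (Fin q)) :
    ‖(WithLp.toLp 2 ((M i - M j).mulVec v.ofLp) : EuclideanSpace ℝ (Fin p))‖
      ≤ modeSpread M * ‖v‖ := by
  have h1 := Matrix.l2_opNorm_mulVec (M i - M j) v
  have h2 : ‖M i - M j‖ ≤ modeSpread M :=
    le_ciSup (f := fun ij : Fin N × Fin N => ‖M ij.1 - M ij.2‖) (finite_range _).bddAbove (i, j)
  exact h1.trans (mul_le_mul_of_nonneg_right h2 (norm_nonneg v))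

open scoped Matrix.Norms.L2Operator in
theorem modeSpread_nonneg {p q N : ℕ} (M : Fin N → Matrix (Fin p) (Fin q) ℝ) :
    0 ≤ modeSpread M :=
  Real.iSup_nonneg fun _ => norm_nonneg _

theorem feedbackGain_nonneg {d c N : ℕ}
    (φ : EuclideanSpace ℝ (Fin d) → Fin N → EuclideanSpace ℝ (Fin c)) : 0 ≤ feedbackGain φ :=
  Real.sSup_nonneg (by rintro _ ⟨ξ, i, -, rfl⟩; exact norm_nonneg _)

/-- The mismatch of the modes is evaluated at the reference state `y` and the input, whose sizes are
controlled, and not at the unknown state `x`. -/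
theorem affineField_sub_affineField {d c N : ℕ} (A : Fin N → Matrix (Fin d) (Fin d) ℝ)
    (B : Fin N → Matrix (Fin d) (Fin c) ℝ) (i j : Fin N) (x y : EuclideanSpace ℝ (Fin d))
    (u : EuclideanSpace ℝ (Fin c)) :
    affineField (A i) (B i) x u - affineField (A j) (B j) y u
      = WithLp.toLp 2 ((A i).mulVec (x - y).ofLp)
        + (WithLp.toLp 2 ((A i - A j).mulVec y.ofLp) + WithLp.toLp 2 ((B i - B j).mulVec u.ofLp)) := by
  simp only [affineField, ← WithLp.toLp_sub, ← WithLp.toLp_add, WithLp.ofLp_sub,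
    Matrix.mulVec_sub, Matrix.sub_mulVec]
  congr 1
  abel

theorem inner_affineField_sub_le {d c N : ℕ} (A : Fin N → Matrix (Fin d) (Fin d) ℝ)
    (B : Fin N → Matrix (Fin d) (Fin c) ℝ) (i j : Fin N) (x y : EuclideanSpace ℝ (Fin d))
    (u : EuclideanSpace ℝ (Fin c)) :
    inner ℝ (x - y) (affineField (A i) (B i) x u - affineField (A j) (B j) y u)
      ≤ growthRate A * ‖x - y‖ ^ 2
        + ‖x - y‖ * (modeSpread A * ‖y‖ + modeSpread B * ‖u‖) := by
  rw [affineField_sub_affineField, inner_add_right]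
  refine add_le_add (inner_mulVec_le_growthRate A i _) ?_
  refine (real_inner_le_norm _ _).trans (mul_le_mul_of_nonneg_left ?_ (norm_nonneg _))
  exact (norm_add_le _ _).trans (add_le_add (norm_sub_mulVec_le_modeSpread A i j y)
    (norm_sub_mulVec_le_modeSpread B i j u))

theorem inner_affineField_sub_le_of_same_mode {d c N : ℕ}
    (A : Fin N → Matrix (Fin d) (Fin d) ℝ)
    (B : Fin N → Matrix (Fin d) (Fin c) ℝ) (i : Fin N) (x y : EuclideanSpace ℝ (Fin d))
    (u : EuclideanSpace ℝ (Fin c)) :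
    inner ℝ (x - y) (affineField (A i) (B i) x u - affineField (A i) (B i) y u)
      ≤ growthRate A * ‖x - y‖ ^ 2 := by
  rw [affineField_sub_affineField, sub_self, sub_self, Matrix.zero_mulVec, Matrix.zero_mulVec]
  simpa using inner_mulVec_le_growthRate A i (x - y)

/-! ### Measurability and linear growth of the feedback. -/

theorem IsPiecewiseContinuous.measurable {E F : Type*} [TopologicalSpace E] [MeasurableSpace E]
    [BorelSpace E] [TopologicalSpace F] [MeasurableSpace F] [BorelSpace F]
    {f : E → F} (hf : IsPiecewiseContinuous f) : Measurable f := by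
  obtain ⟨m, P, hcover, hP⟩ := hf
  have hmeas : ∀ j, MeasurableSet (P j) := fun j => by
    obtain ⟨U, Z, hU, hZ, h⟩ := (hP j).1
    rw [h]
    exact hU.measurableSet.inter hZ.measurableSet
  intro s hs
  have heq : f ⁻¹' s = ⋃ j, (P j ∩ f ⁻¹' s) := by
    rw [← iUnion_inter, hcover, univ_inter]
  rw [heq]
  refine MeasurableSet.iUnion fun j => ?_
  obtain ⟨g, hg, hfg⟩ := (hP j).2
  have hc : ContinuousOn f (P j) := (hg.mono subset_closure).congr hfg
  have hr : Measurable ((P j).domRestrict f) := hc.domRestrict.measurable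
  have := (MeasurableEmbedding.subtype_coe (hmeas j)).measurableSet_image.2 (hr hs)
  convert! this using 1
  ext x
  constructor
  · rintro ⟨h1, h2⟩; exact ⟨⟨x, h1⟩, h2, rfl⟩
  · rintro ⟨⟨y, h1⟩, h2, rfl⟩; exact ⟨h1, h2⟩

/-- On each piece the continuous extension is bounded on the compact set closure(P j) ∩ s. This
makes the supremum defining `feedbackGain` a genuine one. -/
theorem IsPiecewiseContinuous.bddAbove_norm_image {E F : Type*} [TopologicalSpace E]
    [NormedAddCommGroup F] {f : E → F} (hf : IsPiecewiseContinuous f) {s : Set E}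
    (hs : IsCompact s) : BddAbove ((fun x => ‖f x‖) '' s) := by
  obtain ⟨m, P, hcover, hP⟩ := hf
  have hb : ∀ j, ∃ C : ℝ, ∀ x ∈ P j ∩ s, ‖f x‖ ≤ C := by
    intro j
    obtain ⟨g, hg, hfg⟩ := (hP j).2
    obtain ⟨C, hC⟩ := (hs.inter_left isClosed_closure).exists_bound_of_continuousOn
      (hg.mono (inter_subset_left : closure (P j) ∩ s ⊆ _))
    exact ⟨C, fun x hx => by rw [hfg hx.1]; exact hC x ⟨subset_closure hx.1, hx.2⟩⟩
  choose C hC using hb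
  obtain ⟨M, hM⟩ := (finite_range C).bddAbove
  refine ⟨M, ?_⟩
  rintro _ ⟨x, hx, rfl⟩
  have : x ∈ ⋃ j, P j := by rw [hcover]; trivial
  obtain ⟨j, hj⟩ := mem_iUnion.1 this
  exact (hC j x ⟨hj, hx⟩).trans (hM (mem_range_self j))

namespace IsStabilizingFeedback

variable {d c N : ℕ} {A : Fin N → Matrix (Fin d) (Fin d) ℝ}
  {B : Fin N → Matrix (Fin d) (Fin c) ℝ}
  {φ : EuclideanSpace ℝ (Fin d) → Fin N → EuclideanSpace ℝ (Fin c)} {D μ₁ μ₂ : ℝ}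

theorem apply_zero (hφ : IsStabilizingFeedback A B φ D μ₁ μ₂) (i : Fin N) : φ 0 i = 0 := by
  have h := hφ.homogeneous 2 0 i two_pos
  rw [smul_zero, two_smul] at h
  simpa using h

theorem norm_le (hφ : IsStabilizingFeedback A B φ D μ₁ μ₂) (ξ : EuclideanSpace ℝ (Fin d))
    (i : Fin N) : ‖φ ξ i‖ ≤ feedbackGain φ * ‖ξ‖ := by
  rcases eq_or_ne ξ 0 with rfl | hξ
  · simp [hφ.apply_zero]
  have hpos : 0 < ‖ξ‖ := norm_pos_iff.2 hξ
  have hb : BddAbove {r : ℝ | ∃ (ξ : EuclideanSpace ℝ (Fin d)) (i : Fin N),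
      ‖ξ‖ = 1 ∧ r = ‖φ ξ i‖} := by
    have : ∀ i, BddAbove ((fun ξ => ‖φ ξ i‖) '' Metric.sphere (0 : EuclideanSpace ℝ (Fin d)) 1) :=
      fun i => (hφ.piecewiseContinuous i).bddAbove_norm_image (isCompact_sphere _ _)
    choose C hC using this
    obtain ⟨M, hM⟩ := (finite_range C).bddAbove
    refine ⟨M, ?_⟩
    rintro _ ⟨ξ, i, hξ, rfl⟩
    exact (hC i ⟨ξ, by simpa using hξ, rfl⟩).trans (hM (mem_range_self i))
  have hle : ‖φ (‖ξ‖⁻¹ • ξ) i‖ ≤ feedbackGain φ :=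
    le_csSup hb ⟨_, i, by rw [norm_smul, norm_inv, norm_norm, inv_mul_cancel₀ hpos.ne'], rfl⟩
  rw [hφ.homogeneous _ _ _ (inv_pos.2 hpos), norm_smul, norm_inv, norm_norm] at hle
  rwa [inv_mul_le_iff₀ hpos, mul_comm] at hle

theorem measurable (hφ : IsStabilizingFeedback A B φ D μ₁ μ₂) (i : Fin N) :
    Measurable (fun ξ => φ ξ i) :=
  (hφ.piecewiseContinuous i).measurable

end IsStabilizingFeedback

/-! ### Carathéodory solutions and their comparison. -/

namespace IsSolution

variable {d c N : ℕ} {A : Fin N → Matrix (Fin d) (Fin d) ℝ}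
  {B : Fin N → Matrix (Fin d) (Fin c) ℝ} {σ : ℝ → Fin N}
  {u : ℝ → EuclideanSpace ℝ (Fin c)} {x : ℝ → EuclideanSpace ℝ (Fin d)}

theorem intervalIntegrable (h : IsSolution A B σ u x) {a b : ℝ} (ha : 0 ≤ a) (hb : 0 ≤ b) :
    IntervalIntegrable (fun s => affineField (A (σ s)) (B (σ s)) (x s) (u s)) volume a b :=
  (h a ha).1.symm.trans (h b hb).1

theorem sub_eq_integral (h : IsSolution A B σ u x) {a b : ℝ} (ha : 0 ≤ a) (hb : 0 ≤ b) :
    x b - x a = ∫ s in a..b, affineField (A (σ s)) (B (σ s)) (x s) (u s) := by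
  rw [(h b hb).2, (h a ha).2, add_sub_add_left_eq_sub,
    intervalIntegral.integral_interval_sub_left (h b hb).1 (h a ha).1]

theorem continuousOn (h : IsSolution A B σ u x) {T : ℝ} (hT : 0 ≤ T) :
    ContinuousOn x (Icc 0 T) := by
  have h1 := intervalIntegral.continuousOn_primitive_interval' (h T hT).1 left_mem_uIcc
  rw [uIcc_of_le hT] at h1
  exact (continuousOn_const.add h1).congr fun t ht => (h t ht.1).2

/-- Over a time window on which both systems receive the same input, a solution stays close to a
solution of a fixed mode `i`. -/
theorem norm_sub_le (h : IsSolution A B σ u x) {i : Fin N} {w : ℝ → EuclideanSpace ℝ (Fin c)}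
    {v : ℝ → EuclideanSpace ℝ (Fin d)} (hv : IsSolution A B (fun _ => i) w v) {T₀ τ W : ℝ}
    (hT₀ : 0 ≤ T₀) (hu : ∀ s ∈ Ioo 0 τ, u (T₀ + s) = w s)
    (hνW : 0 ≤ growthRate A ∨ W = 0) (hW : 0 ≤ W)
    (hmode : ∀ s ∈ Ioo 0 τ, σ (T₀ + s) = i ∨
      modeSpread A * ‖v s‖ + modeSpread B * ‖w s‖ ≤ W) :
    ∀ s ∈ Icc 0 τ, ‖x (T₀ + s) - v s‖ ≤
      Real.exp (growthRate A * s) * (‖x T₀ - v 0‖ + s * W) := by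
  rcases lt_or_ge τ 0 with hτ | hτ
  · intro t ht; exact absurd (ht.1.trans ht.2) (not_le.2 hτ)
  set f : ℝ → EuclideanSpace ℝ (Fin d) :=
    fun s => affineField (A (σ s)) (B (σ s)) (x s) (u s) with hf
  set g : ℝ → EuclideanSpace ℝ (Fin d) := fun s => affineField (A i) (B i) (v s) (w s) with hg
  have hfi : ∀ t, 0 ≤ t → IntervalIntegrable (fun s => f (T₀ + s)) volume 0 t := by
    intro t ht
    have := (h.intervalIntegrable hT₀ (add_nonneg hT₀ ht)).comp_add_left T₀
    simpa using this
  have hgi : ∀ t, 0 ≤ t → IntervalIntegrable g volume 0 t := fun t ht => (hv t ht).1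
  have hmain := norm_le_of_inner_le (e := fun s => x (T₀ + s) - v s)
    (f := fun s => f (T₀ + s) - g s) (T := τ) (ν := growthRate A) (W := W)
    ((hfi τ hτ).sub (hgi τ hτ)) ?_ ?_ hW hνW
  · simpa using hmain
  · intro t ht
    rw [intervalIntegral.integral_sub (hfi t ht.1) (hgi t ht.1)]
    have h1 := h.sub_eq_integral hT₀ (add_nonneg hT₀ ht.1)
    have h2 := (hv t ht.1).2
    have h3 : ∫ s in (0 : ℝ)..t, f (T₀ + s) = x (T₀ + t) - x T₀ := by
      rw [intervalIntegral.integral_comp_add_left (fun s => f s) T₀, add_zero, h1]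
    rw [h3, h2, add_zero]
    abel
  · intro s hs
    simp only [hf, hg, hu s hs]
    rcases hmode s hs with hm | hm
    · rw [hm]
      refine (inner_affineField_sub_le_of_same_mode A B i _ _ _).trans ?_
      have := mul_nonneg (norm_nonneg (x (T₀ + s) - v s)) hW
      linarith
    · refine (inner_affineField_sub_le A B _ _ _ _ _).trans ?_
      have := mul_le_mul_of_nonneg_left hm (norm_nonneg (x (T₀ + s) - v s))
      linarith

theorem zero_solution (i : Fin N) :
    IsSolution A B (fun _ => i) (fun _ => 0) (fun _ => 0) := by
  intro t _
  have h : affineField (A i) (B i) (0 : EuclideanSpace ℝ (Fin d)) 0 = 0 := by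
    simp [affineField]
  simp [h]

end IsSolution

/-! ### Signals that are constant on sampling intervals. -/

theorem isSwitchingSignal_const {N : ℕ} (i : Fin N) : IsSwitchingSignal (fun _ => i) where
  rightCont _ _ := continuousWithinAt_const
  finite_switches T := by
    have : {s : ℝ | s ∈ Ico 0 T ∧ ¬ ContinuousWithinAt (fun _ : ℝ => i) (Ici 0) s} = ∅ := by
      ext s
      simp [continuousWithinAt_const]
    rw [this]
    exact finite_empty

/-- The signal with value `md k` on `[k τ, (k + 1) τ)`. -/
noncomputable def stepSignal {N : ℕ} (τ : ℝ) (md : ℕ → Fin N) : ℝ → Fin N := fun t => md ⌊t / τ⌋₊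

theorem floor_div_eq_of_mem_Ico {τ t : ℝ} (hτ : 0 < τ) {k : ℕ}
    (ht : t ∈ Ico ((k : ℝ) * τ) (((k : ℝ) + 1) * τ)) : ⌊t / τ⌋₊ = k := by
  have h0 : 0 ≤ t := le_trans (by positivity) ht.1
  rw [Nat.floor_eq_iff (div_nonneg h0 hτ.le), le_div_iff₀ hτ, div_lt_iff₀ hτ]
  exact ht

theorem mem_Ico_floor_div {τ t : ℝ} (hτ : 0 < τ) (ht : 0 ≤ t) :
    t ∈ Ico ((⌊t / τ⌋₊ : ℝ) * τ) (((⌊t / τ⌋₊ : ℝ) + 1) * τ) := by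
  rw [mem_Ico, ← le_div_iff₀ hτ, ← div_lt_iff₀ hτ]
  exact ⟨Nat.floor_le (div_nonneg ht hτ.le), Nat.lt_floor_add_one _⟩

section stepSignal

variable {N : ℕ} {τ : ℝ} {md : ℕ → Fin N}

theorem stepSignal_eq (hτ : 0 < τ) {k : ℕ} {t : ℝ}
    (ht : t ∈ Ico ((k : ℝ) * τ) (((k : ℝ) + 1) * τ)) : stepSignal τ md t = md k := by
  rw [stepSignal, floor_div_eq_of_mem_Ico hτ ht]

theorem exists_of_not_continuousWithinAt_stepSignal (hτ : 0 < τ) {r : ℝ} (hr : 0 ≤ r)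
    (h : ¬ ContinuousWithinAt (stepSignal τ md) (Ici 0) r) :
    ∃ k : ℕ, r = ((k : ℝ) + 1) * τ ∧ md k ≠ md (k + 1) := by
  by_contra! hcon
  apply h
  obtain ⟨k, hk⟩ : ∃ k, k = ⌊r / τ⌋₊ := ⟨_, rfl⟩
  have hmem := mem_Ico_floor_div hτ hr
  rw [← hk] at hmem
  have hval : stepSignal τ md r = md k := stepSignal_eq hτ hmem
  have hev : ∀ᶠ t in 𝓝[Ici 0] r, stepSignal τ md t = stepSignal τ md r := by
    rw [hval]
    rcases eq_or_lt_of_le hmem.1 with heq | hlt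
    -- Signals live on [0, ∞), so time 0 is never a discontinuity; at a later grid point the two
    -- adjacent modes coincide.
    · rcases k with _ | k
      · have : Iio τ ∈ 𝓝 r := Iio_mem_nhds (by simpa using hmem.2)
        filter_upwards [mem_nhdsWithin_of_mem_nhds this, self_mem_nhdsWithin] with t ht ht0
        exact stepSignal_eq hτ ⟨by simpa using ht0, by simpa using ht⟩
      · push_cast at heq hmem
        have hmd := hcon k heq.symm
        have : Ioo ((k : ℝ) * τ) (((k : ℝ) + 1 + 1) * τ) ∈ 𝓝 r :=
          Ioo_mem_nhds (by rw [← heq]; nlinarith) hmem.2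
        filter_upwards [mem_nhdsWithin_of_mem_nhds this] with t ht
        rcases lt_or_ge t (((k : ℝ) + 1) * τ) with h1 | h1
        · rw [stepSignal_eq hτ ⟨ht.1.le, h1⟩, hmd]
        · exact stepSignal_eq hτ ⟨by push_cast; exact h1, by push_cast; exact ht.2⟩
    · filter_upwards [mem_nhdsWithin_of_mem_nhds (Ioo_mem_nhds hlt hmem.2)] with t ht
      exact stepSignal_eq hτ ⟨ht.1.le, ht.2⟩
  exact tendsto_nhds_of_eventually_eq hev

theorem switches_stepSignal_subset (hτ : 0 < τ) {T : ℝ} {m : ℕ} (hT : T ≤ m * τ) :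
    {s : ℝ | s ∈ Ico 0 T ∧ ¬ ContinuousWithinAt (stepSignal τ md) (Ici 0) s} ⊆
      ((Finset.range m).filter fun k => md k ≠ md (k + 1)).image
        (fun k : ℕ => ((k : ℝ) + 1) * τ) := by
  rintro s ⟨hs, hns⟩
  obtain ⟨k, rfl, hk⟩ := exists_of_not_continuousWithinAt_stepSignal hτ hs.1 hns
  have hlt : ((k : ℝ) + 1) < m := lt_of_mul_lt_mul_right (hs.2.trans_le hT) hτ.le
  have : k < m := by
    have : ((k + 1 : ℕ) : ℝ) < m := by push_cast; exact hlt
    have := Nat.cast_lt.1 this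
    omega
  simp only [Finset.coe_image, mem_image, Finset.mem_coe, Finset.mem_filter, Finset.mem_range]
  exact ⟨k, ⟨this, hk⟩, rfl⟩

theorem isSwitchingSignal_stepSignal (hτ : 0 < τ) : IsSwitchingSignal (stepSignal τ md) where
  rightCont t ht := by
    have hmem := mem_Ico_floor_div hτ ht
    refine tendsto_nhds_of_eventually_eq ?_
    filter_upwards [mem_nhdsWithin_of_mem_nhds (Iio_mem_nhds hmem.2), self_mem_nhdsWithin]
      with s hs hs'
    rw [stepSignal_eq hτ hmem, stepSignal_eq hτ ⟨hmem.1.trans hs', hs⟩]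
  finite_switches T := by
    obtain ⟨m, hm⟩ := exists_nat_ge (T / τ)
    exact (Finset.finite_toSet _).subset
      (switches_stepSignal_subset hτ ((div_le_iff₀ hτ).1 hm))

theorem numSwitches_stepSignal_le (hτ : 0 < τ) {T : ℝ} {m : ℕ} (hT : T ≤ m * τ) :
    numSwitches (stepSignal τ md) T 0 ≤ ((Finset.range m).filter fun k => md k ≠ md (k + 1)).card := by
  refine (ncard_le_ncard (switches_stepSignal_subset hτ hT) (Finset.finite_toSet _)).trans ?_
  rw [ncard_coe_finset]
  exact Finset.card_image_le

end stepSignal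

/-! ### The simulated closed loop along a mode sequence; solutions need not be unique, so chosen
ones are concatenated. -/

namespace IsStabilizingFeedback

variable {d c N : ℕ} {A : Fin N → Matrix (Fin d) (Fin d) ℝ}
  {B : Fin N → Matrix (Fin d) (Fin c) ℝ}
  {φ : EuclideanSpace ℝ (Fin d) → Fin N → EuclideanSpace ℝ (Fin c)} {D μ₁ μ₂ : ℝ}

/-- A chosen solution of the closed loop in the fixed mode `i` with initial state `x₀`. -/
noncomputable def modeSol (hφ : IsStabilizingFeedback A B φ D μ₁ μ₂) (i : Fin N)
    (x₀ : EuclideanSpace ℝ (Fin d)) : ℝ → EuclideanSpace ℝ (Fin d) :=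
  (hφ.exists_solution (fun _ => i) (isSwitchingSignal_const i) x₀).choose

variable (hφ : IsStabilizingFeedback A B φ D μ₁ μ₂)

theorem modeSol_zero (i : Fin N) (x₀ : EuclideanSpace ℝ (Fin d)) : hφ.modeSol i x₀ 0 = x₀ :=
  (hφ.exists_solution (fun _ => i) (isSwitchingSignal_const i) x₀).choose_spec.1

theorem isSolution_modeSol (i : Fin N) (x₀ : EuclideanSpace ℝ (Fin d)) :
    IsSolution A B (fun _ => i) (fun t => φ (hφ.modeSol i x₀ t) i) (hφ.modeSol i x₀) :=
  (hφ.exists_solution (fun _ => i) (isSwitchingSignal_const i) x₀).choose_spec.2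

/-- The decay estimate forces every closed-loop solution from 0 to vanish, whichever one was chosen.
-/
theorem modeSol_of_zero (i : Fin N) {t : ℝ} (ht : 0 ≤ t) : hφ.modeSol i 0 t = 0 := by
  have h := hφ.bound (fun _ => i) (isSwitchingSignal_const i) _ (hφ.isSolution_modeSol i 0) t ht
  rw [hφ.modeSol_zero, norm_zero, mul_zero, zero_mul] at h
  exact norm_le_zero_iff.1 h

theorem integrableOn_feedback_modeSol (i : Fin N) (x₀ : EuclideanSpace ℝ (Fin d)) {T : ℝ}
    (hT : 0 ≤ T) : IntegrableOn (fun t => φ (hφ.modeSol i x₀ t) i) (Icc 0 T) volume := by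
  have hc := (hφ.isSolution_modeSol i x₀).continuousOn hT
  obtain ⟨M, hM⟩ := isCompact_Icc.exists_bound_of_continuousOn hc
  have hm : AEMeasurable (hφ.modeSol i x₀) (volume.restrict (Icc 0 T)) :=
    hc.aemeasurable measurableSet_Icc
  refine Integrable.of_bound ((hφ.measurable i).comp_aemeasurable hm).aestronglyMeasurable
    (feedbackGain φ * M) ?_
  · refine (ae_restrict_iff' measurableSet_Icc).2 (ae_of_all _ fun t ht => ?_)
    exact (hφ.norm_le _ i).trans (mul_le_mul_of_nonneg_left (hM t ht) (feedbackGain_nonneg φ))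

/-- The states at the times `k τ` of the chosen closed-loop solution whose mode on
`[k τ, (k + 1) τ)` is `md k`. -/
noncomputable def gridState (τ : ℝ) (md : ℕ → Fin N) (z : EuclideanSpace ℝ (Fin d)) :
    ℕ → EuclideanSpace ℝ (Fin d)
  | 0 => z
  | k + 1 => hφ.modeSol (md k) (gridState τ md z k) τ

/-- The chosen closed-loop solution whose mode on `[k τ, (k + 1) τ)` is `md k`. -/
noncomputable def stepSol (τ : ℝ) (md : ℕ → Fin N) (z : EuclideanSpace ℝ (Fin d)) (t : ℝ) :
    EuclideanSpace ℝ (Fin d) :=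
  hφ.modeSol (md ⌊t / τ⌋₊) (hφ.gridState τ md z ⌊t / τ⌋₊) (t - ⌊t / τ⌋₊ * τ)

variable {τ : ℝ}

theorem stepSol_eq (hτ : 0 < τ) (md : ℕ → Fin N) (z : EuclideanSpace ℝ (Fin d)) {k : ℕ} {t : ℝ} (ht : t ∈ Icc ((k : ℝ) * τ) (((k : ℝ) + 1) * τ)) :
    hφ.stepSol τ md z t = hφ.modeSol (md k) (hφ.gridState τ md z k) (t - k * τ) := by
  rcases eq_or_lt_of_le ht.2 with heq | hlt
  -- At the right end the floor already jumps to the next interval, whose initial state is by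
  -- construction the final state of this one.
  · have hfl : ⌊t / τ⌋₊ = k + 1 := by
      refine floor_div_eq_of_mem_Ico hτ ⟨by push_cast; exact heq.ge, ?_⟩
      push_cast
      nlinarith
    rw [stepSol, hfl, heq]
    push_cast
    rw [sub_self, hφ.modeSol_zero, gridState]
    congr 1
    ring
  · rw [stepSol, floor_div_eq_of_mem_Ico hτ ⟨ht.1, hlt⟩]

theorem stepSol_zero (hτ : 0 < τ) (md : ℕ → Fin N) (z : EuclideanSpace ℝ (Fin d)) : hφ.stepSol τ md z 0 = z := by
  rw [hφ.stepSol_eq hτ md z (k := 0) ⟨by simp, by simpa using hτ.le⟩]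
  simp [hφ.modeSol_zero, gridState]

/-- This allows the decay assumption to be applied once to the whole concatenation. Applying it to
each piece separately would cost a factor `D` per sampling interval. -/
theorem isSolution_stepSol (hτ : 0 < τ) (md : ℕ → Fin N) (z : EuclideanSpace ℝ (Fin d)) :
    IsSolution A B (stepSignal τ md)
      (fun t => φ (hφ.stepSol τ md z t) (stepSignal τ md t)) (hφ.stepSol τ md z) := by
  set f : ℝ → EuclideanSpace ℝ (Fin d) := fun s => affineField (A (stepSignal τ md s))
    (B (stepSignal τ md s)) (hφ.stepSol τ md z s)
    (φ (hφ.stepSol τ md z s) (stepSignal τ md s)) with hf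
  set F : ℕ → ℝ → EuclideanSpace ℝ (Fin d) := fun k s => affineField (A (md k)) (B (md k))
    (hφ.modeSol (md k) (hφ.gridState τ md z k) s)
    (φ (hφ.modeSol (md k) (hφ.gridState τ md z k) s) (md k)) with hF
  have hloc : ∀ (k : ℕ), ∀ t ∈ Icc ((k : ℝ) * τ) (((k : ℝ) + 1) * τ),
      IntervalIntegrable f volume (k * τ) t ∧
        hφ.stepSol τ md z t = hφ.gridState τ md z k + ∫ s in (k * τ)..t, f s := by
    intro k t ht
    have hsol := hφ.isSolution_modeSol (md k) (hφ.gridState τ md z k) (t - k * τ)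
      (sub_nonneg.2 ht.1)
    have heq : EqOn (fun s => F k (s - k * τ)) f (Ioo (k * τ) t) := by
      intro s hs
      have hs' : s ∈ Ico ((k : ℝ) * τ) (((k : ℝ) + 1) * τ) := ⟨hs.1.le, hs.2.trans_le ht.2⟩
      simp only [hf, hF, stepSignal_eq hτ hs', hφ.stepSol_eq hτ md z (Ico_subset_Icc_self hs')]
    constructor
    · have := hsol.1.comp_sub_right (k * τ)
      rw [zero_add, sub_add_cancel] at this
      refine this.congr_uIoo ?_
      rwa [uIoo_of_le ht.1]
    · rw [← intervalIntegral.integral_congr_Ioo_of_le ht.1 heq,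
        intervalIntegral.integral_comp_sub_right (fun s => F k s), sub_self,
        hφ.stepSol_eq hτ md z ht, hsol.2, hφ.modeSol_zero]
  have hgrid : ∀ k : ℕ, IntervalIntegrable f volume 0 (k * τ) ∧
      hφ.gridState τ md z k = z + ∫ s in (0 : ℝ)..(k * τ), f s := by
    intro k
    induction k with
    | zero => simp [gridState]
    | succ k ih =>
      have hle : (k : ℝ) * τ ≤ ((k : ℝ) + 1) * τ := by nlinarith
      obtain ⟨h1, h2⟩ := hloc k (((k : ℝ) + 1) * τ) ⟨hle, le_rfl⟩
      push_cast
      refine ⟨ih.1.trans h1, ?_⟩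
      rw [← intervalIntegral.integral_add_adjacent_intervals ih.1 h1, ← add_assoc, ← ih.2, ← h2,
        hφ.stepSol_eq hτ md z ⟨hle, le_rfl⟩, gridState]
      congr 1
      ring
  intro t ht
  have hmem := Ico_subset_Icc_self (mem_Ico_floor_div hτ ht)
  obtain ⟨h1, h2⟩ := hloc _ t hmem
  obtain ⟨h3, h4⟩ := hgrid ⌊t / τ⌋₊
  refine ⟨h3.trans h1, ?_⟩
  rw [h2, h4, hφ.stepSol_zero hτ, add_assoc,
    intervalIntegral.integral_add_adjacent_intervals h3 h1]

/-- The decay of the closed loop along a mode sequence with at most `p` changes. -/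
theorem norm_stepSol_le (hτ : 0 < τ) (md : ℕ → Fin N) (z : EuclideanSpace ℝ (Fin d)) (hD : 0 ≤ D) (hμ₁ : 0 ≤ μ₁) {m p : ℕ}
    (hp : ((Finset.range m).filter fun k => md k ≠ md (k + 1)).card ≤ p) {t : ℝ} (ht : 0 ≤ t)
    (htm : t ≤ m * τ) :
    ‖hφ.stepSol τ md z t‖ ≤ D * ‖z‖ * Real.exp (μ₁ * p - μ₂ * t) := by
  have h := hφ.bound _ (isSwitchingSignal_stepSignal hτ) _ (hφ.isSolution_stepSol hτ md z) t ht
  rw [hφ.stepSol_zero hτ] at h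
  refine h.trans ?_
  have : (numSwitches (stepSignal τ md) t 0 : ℝ) ≤ p :=
    Nat.cast_le.2 ((numSwitches_stepSignal_le hτ htm).trans hp)
  gcongr

theorem gridState_eq_stepSol (hτ : 0 < τ) (md : ℕ → Fin N) (z : EuclideanSpace ℝ (Fin d)) (k : ℕ) : hφ.gridState τ md z k = hφ.stepSol τ md z (k * τ) := by
  rw [hφ.stepSol_eq hτ md z (k := k) ⟨le_rfl, by nlinarith⟩, sub_self, hφ.modeSol_zero]

theorem gridState_of_zero (hτ : 0 ≤ τ) (md : ℕ → Fin N) (k : ℕ) : hφ.gridState τ md 0 k = 0 := by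
  induction k with
  | zero => rfl
  | succ k ih => rw [gridState, ih, hφ.modeSol_of_zero _ hτ]

end IsStabilizingFeedback

/-! ### Quantization of the unit ball. -/

theorem exists_scalar_quantizer (m : ℕ) :
    ∃ (q : ℝ → Fin (2 * m + 1)) (ctr : Fin (2 * m + 1) → ℝ),
      (∀ y : ℝ, |y| ≤ 1 → |y - ctr (q y)| ≤ 1 / (2 * m + 1)) ∧
      ∀ y : ℝ, |y| < 1 / (2 * m + 1) → ctr (q y) = 0 := by
  have hk : (0 : ℝ) < 2 * m + 1 := by positivity
  -- [-1, 1] is divided into 2m + 1 cells of length 2/(2m + 1), the middle one centred at 0.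
  -- Half-integers round up, so y = 1 would get index 2m + 1, and `min` returns it to the last cell.
  refine ⟨fun y => ⟨min (round (y * (2 * m + 1) / 2) + m).toNat (2 * m), by omega⟩,
    fun j => 2 * ((j : ℕ) - m : ℝ) / (2 * m + 1), fun y hy => ?_, fun y hy => ?_⟩
  · obtain ⟨r, hr⟩ : ∃ r, r = round (y * (2 * m + 1) / 2) := ⟨_, rfl⟩
    simp only [← hr]
    have h1 := abs_sub_round (y * (2 * m + 1) / 2)
    rw [← hr, abs_le] at h1
    rw [abs_le] at hy
    have hlow : -(m : ℤ) - 1 < r := by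
      have : (-(m : ℝ) - 1) ≤ r := by nlinarith
      rcases eq_or_lt_of_le this with h | h
      -- Equality would force y = -1, but then -m - 1/2 rounds up to -m.
      · exfalso
        have hy' : y * (2 * m + 1) / 2 = -(m : ℝ) - 1 / 2 := by nlinarith
        rw [hy'] at hr
        have : round (-(m : ℝ) - 1 / 2) = -(m : ℤ) := by
          rw [round_eq, Int.floor_eq_iff]; push_cast; constructor <;> linarith
        rw [this] at hr
        rw [hr] at h
        push_cast at h
        linarith
      · exact_mod_cast h
    have hup : r ≤ m + 1 := by
      have : (r : ℝ) ≤ m + 1 := by nlinarith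
      exact_mod_cast this
    rw [abs_le]
    rcases eq_or_lt_of_le hup with h | h
    · have hv : min (r + m).toNat (2 * m) = 2 * m := by omega
      rw [hv]
      have hr' : (r : ℝ) = m + 1 := by exact_mod_cast h
      rw [hr'] at h1
      push_cast
      constructor
      · rw [neg_le_sub_iff_le_add, ← sub_le_iff_le_add, ← sub_div, div_le_iff₀ hk]; nlinarith
      · rw [sub_le_iff_le_add, ← add_div, le_div_iff₀ hk]; nlinarith
    · have hv : ((min (r + m).toNat (2 * m) : ℕ) : ℤ) = r + m := by omega
      have hv' : ((min (r + m).toNat (2 * m) : ℕ) : ℝ) = r + m := by exact_mod_cast hv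
      rw [hv']
      constructor
      · rw [neg_le_sub_iff_le_add, ← sub_le_iff_le_add, ← sub_div, div_le_iff₀ hk]
        nlinarith
      · rw [sub_le_iff_le_add, ← add_div, le_div_iff₀ hk]
        nlinarith
  · have hr : round (y * (2 * m + 1) / 2) = 0 := by
      rw [abs_lt, ← neg_div, lt_div_iff₀ hk, div_lt_iff₀ hk] at hy
      rw [round_eq, Int.floor_eq_iff]
      push_cast
      constructor <;> linarith [hy.1, hy.2]
    simp only [hr]
    have hv : min ((0 : ℤ) + m).toNat (2 * m) = m := by omega
    rw [hv]
    simp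

/-- Centres of cells near the corners of the cube may lie outside the unit ball. Scaling them back
to the sphere costs no accuracy for points of the ball and ensures that a quantized state never
exceeds the bound ρ. -/
theorem norm_sub_unit_retraction_le {E : Type*} [NormedAddCommGroup E] [InnerProductSpace ℝ E]
    {y c : E} (hy : ‖y‖ ≤ 1) (hc : 1 < ‖c‖) : ‖y - ‖c‖⁻¹ • c‖ ≤ ‖y - c‖ := by
  have hpos : 0 < ‖c‖ := by linarith
  refine (pow_le_pow_iff_left₀ (norm_nonneg _) (norm_nonneg _) two_ne_zero).1 ?_
  rw [norm_sub_sq_real, norm_sub_sq_real, inner_smul_right, norm_smul, norm_inv, norm_norm,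
    inv_mul_cancel₀ hpos.ne']
  have hin : inner ℝ y c ≤ ‖c‖ :=
    (real_inner_le_norm y c).trans (mul_le_of_le_one_left hpos.le hy)
  have h1 : inner ℝ y c * (1 - ‖c‖⁻¹) ≤ ‖c‖ * (1 - ‖c‖⁻¹) :=
    mul_le_mul_of_nonneg_right hin (sub_nonneg.2 (inv_le_one_of_one_le₀ hc.le))
  have h2 : ‖c‖ * (1 - ‖c‖⁻¹) = ‖c‖ - 1 := by field_simp
  nlinarith [sq_nonneg (‖c‖ - 1)]

/-- A quantizer of the unit ball with `(2 m + 1) ^ d` cells, accuracy `α`, quantization points in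
the unit ball, and a cell around the origin that is quantized to the origin. -/
theorem exists_quantizer (d m : ℕ) {α : ℝ} (hm : Real.sqrt d ≤ α * (2 * m + 1)) :
    ∃ (q : EuclideanSpace ℝ (Fin d) → (Fin d → Fin (2 * m + 1)))
      (ctr : (Fin d → Fin (2 * m + 1)) → EuclideanSpace ℝ (Fin d)),
      (∀ s, ‖ctr s‖ ≤ 1) ∧ (∀ y, ‖y‖ ≤ 1 → ‖y - ctr (q y)‖ ≤ α) ∧
      ∃ δ : ℝ, 0 < δ ∧ ∀ y, ‖y‖ ≤ δ → ctr (q y) = 0 := by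
  obtain ⟨q, ctr, hacc, hzero⟩ := exists_scalar_quantizer m
  have hk : (0 : ℝ) < 2 * m + 1 := by positivity
  let raw : (Fin d → Fin (2 * m + 1)) → EuclideanSpace ℝ (Fin d) :=
    fun s => WithLp.toLp 2 fun i => ctr (s i)
  have hcoord : ∀ (y : EuclideanSpace ℝ (Fin d)) (i : Fin d), |y i| ≤ ‖y‖ :=
    fun y i => PiLp.norm_apply_le y i
  refine ⟨fun y i => q (y i), fun s => if ‖raw s‖ ≤ 1 then raw s else ‖raw s‖⁻¹ • raw s,
    -- δ is half of the half-width of the central cell, so every coordinate lies strictly inside it.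
    fun s => ?_, fun y hy => ?_, 1 / (2 * (2 * m + 1)), by positivity, fun y hy => ?_⟩
  · dsimp only
    split_ifs with h
    · exact h
    · rw [norm_smul, norm_inv, norm_norm, inv_mul_cancel₀]
      linarith
  · have hraw : ‖y - raw fun i => q (y i)‖ ≤ α := by
      have hsq : ‖y - raw fun i => q (y i)‖ ^ 2 ≤ d * (1 / (2 * m + 1)) ^ 2 := by
        rw [EuclideanSpace.real_norm_sq_eq]
        refine (Finset.sum_le_card_nsmul _ _ ((1 / (2 * m + 1 : ℝ)) ^ 2) fun i _ => ?_).trans ?_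
        · have := hacc (y i) ((hcoord y i).trans hy)
          rw [← sq_abs]
          exact pow_le_pow_left₀ (abs_nonneg _) this 2
        · simp
      have hle : ‖y - raw fun i => q (y i)‖ ≤ Real.sqrt d * (1 / (2 * m + 1)) := by
        refine (pow_le_pow_iff_left₀ (norm_nonneg _) (by positivity) two_ne_zero).1 ?_
        rwa [mul_pow, Real.sq_sqrt (Nat.cast_nonneg d)]
      refine hle.trans ?_
      rwa [mul_one_div, div_le_iff₀ hk]
    dsimp only
    split_ifs with h
    · exact hraw
    · exact (norm_sub_unit_retraction_le hy (not_le.1 h)).trans hraw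
  · have h0 : (raw fun i => q (y i)) = 0 := by
      ext i
      refine hzero (y i) (((hcoord y i).trans hy).trans_lt ?_)
      exact one_div_lt_one_div_of_lt hk (by linarith)
    simp [h0]

/-! ### Product of the block factors and counting of switches. -/

/-- Each logarithm is bounded by its tangent at p = s, via 1 + x ≤ e^x. The deviations p j - s then
add up to at most `M`, so an uneven distribution of switches costs only a constant. -/
theorem prod_exp_mul_affine_le {a b μ s M : ℝ} (ha : 0 < a) (hb : 0 ≤ b) (hμ : 0 ≤ μ) (hs : 0 ≤ s)
    (p : ℕ → ℕ) (J : ℕ) (hp : ((∑ j ∈ Finset.range J, p j : ℕ) : ℝ) ≤ M + J * s) :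
    ∏ j ∈ Finset.range J, (Real.exp (μ * p j) * (a + b * p j)) ≤
      Real.exp ((μ + b / (a + b * s)) * M) * (Real.exp (μ * s) * (a + b * s)) ^ J := by
  have hX : 0 < a + b * s := by positivity
  set κ := b / (a + b * s) with hκ
  have hκ0 : 0 ≤ κ := by positivity
  have hfac : ∀ j, Real.exp (μ * p j) * (a + b * p j) ≤
      Real.exp (μ * s) * (a + b * s) * Real.exp ((μ + κ) * (p j - s)) := by
    intro j
    have h1 : a + b * p j = (a + b * s) * (κ * (p j - s) + 1) := by
      rw [hκ]; field_simp; ring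
    have h2 : a + b * p j ≤ (a + b * s) * Real.exp (κ * (p j - s)) := by
      rw [h1]
      exact mul_le_mul_of_nonneg_left (Real.add_one_le_exp _) hX.le
    have h3 : Real.exp (μ * s) * (a + b * s) * Real.exp ((μ + κ) * (p j - s)) =
        Real.exp (μ * p j) * ((a + b * s) * Real.exp (κ * (p j - s))) := by
      have : Real.exp (μ * p j) * Real.exp (κ * (p j - s)) =
          Real.exp (μ * s) * Real.exp ((μ + κ) * (p j - s)) := by
        rw [← Real.exp_add, ← Real.exp_add]; congr 1; ring
      linear_combination -(a + b * s) * this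
    rw [h3]
    exact mul_le_mul_of_nonneg_left h2 (Real.exp_nonneg _)
  refine (Finset.prod_le_prod (fun j _ => by positivity) fun j _ => hfac j).trans ?_
  rw [Finset.prod_mul_distrib, Finset.prod_const, Finset.card_range, ← Real.exp_sum,
    ← Finset.mul_sum, Finset.sum_sub_distrib, Finset.sum_const, Finset.card_range, nsmul_eq_mul,
    mul_comm]
  refine mul_le_mul_of_nonneg_right (Real.exp_le_exp.2 ?_) (by positivity)
  refine mul_le_mul_of_nonneg_left ?_ (by positivity)
  push_cast at hp
  linarith

section switchCount

variable {N : ℕ} {σ : ℝ → Fin N}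

/-- `σ` switches in the window `(k τ, (k + 1) τ]`. -/
def SwitchesIn (σ : ℝ → Fin N) (τ : ℝ) (k : ℕ) : Prop :=
  ∃ r ∈ Ioc ((k : ℝ) * τ) (((k : ℝ) + 1) * τ), ¬ ContinuousWithinAt σ (Ici 0) r

open Classical in
/-- The number of windows with index in `[k, k + n)` in which `σ` switches. -/
noncomputable def windowCount (σ : ℝ → Fin N) (τ : ℝ) (k n : ℕ) : ℕ :=
  ∑ i ∈ Finset.range n, if SwitchesIn σ τ (k + i) then 1 else 0

theorem windowCount_le (τ : ℝ) (k n : ℕ) : windowCount σ τ k n ≤ n := by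
  classical
  rw [windowCount, ← Finset.card_filter]
  exact (Finset.card_filter_le _ _).trans (Finset.card_range n).le

theorem windowCount_mono (τ : ℝ) (k : ℕ) {m n : ℕ} (h : m ≤ n) :
    windowCount σ τ k m ≤ windowCount σ τ k n :=
  Finset.sum_le_sum_of_subset (Finset.range_mono h)

theorem sum_windowCount (τ : ℝ) (n J : ℕ) :
    ∑ j ∈ Finset.range J, windowCount σ τ (j * n) n = windowCount σ τ 0 (J * n) := by
  induction J with
  | zero => simp [windowCount]
  | succ J ih =>
    rw [Finset.sum_range_succ, ih, Nat.succ_mul]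
    unfold windowCount
    rw [Finset.sum_range_add]
    congr 1
    exact Finset.sum_congr rfl fun i _ => by rw [zero_add]

/-- A switch at the left end is harmless by right-continuity. The right end belongs to the window,
so the next sample is covered too. -/
theorem IsSwitchingSignal.eq_of_not_switchesIn (hσ : IsSwitchingSignal σ) {τ : ℝ} (hτ : 0 ≤ τ)
    {k : ℕ} (h : ¬ SwitchesIn σ τ k) :
    ∀ t ∈ Icc ((k : ℝ) * τ) (((k : ℝ) + 1) * τ), σ t = σ (k * τ) := by
  have h0 : 0 ≤ (k : ℝ) * τ := by positivity
  have hc : ContinuousOn σ (Icc ((k : ℝ) * τ) (((k : ℝ) + 1) * τ)) := by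
    intro t ht
    rcases eq_or_lt_of_le ht.1 with heq | hlt
    · rw [← heq]
      exact (hσ.rightCont _ h0).mono Icc_subset_Ici_self
    · have : ContinuousWithinAt σ (Ici 0) t := by
        by_contra hcon
        exact h ⟨t, ⟨hlt, ht.2⟩, hcon⟩
      exact this.mono fun s hs => h0.trans hs.1
  intro t ht
  exact isPreconnected_Icc.constant hc ht ⟨le_rfl, ht.1.trans ht.2⟩

/-- The windows are disjoint, so switches picked from different windows are distinct. The last
window contains its right end while `numSwitches` excludes its upper limit; hence the extra η. -/
theorem IsSwitchingSignal.windowCount_le_numSwitches (hσ : IsSwitchingSignal σ) {τ η : ℝ}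
    (hτ : 0 < τ) (hη : 0 < η) (m : ℕ) :
    windowCount σ τ 0 m ≤ numSwitches σ (m * τ + η) 0 := by
  classical
  rw [windowCount, ← Finset.card_filter]
  have hex : ∀ k, ∃ r, SwitchesIn σ τ k →
      r ∈ Ioc ((k : ℝ) * τ) (((k : ℝ) + 1) * τ) ∧ ¬ ContinuousWithinAt σ (Ici 0) r := by
    intro k
    by_cases h : SwitchesIn σ τ k
    · obtain ⟨r, h1, h2⟩ := h
      exact ⟨r, fun _ => ⟨h1, h2⟩⟩
    · exact ⟨0, fun h' => absurd h' h⟩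
  choose r hr using hex
  have hinj : Set.InjOn r (((Finset.range m).filter fun i => SwitchesIn σ τ (0 + i)) : Set ℕ) := by
    intro i hi j hj hij
    simp only [Finset.coe_filter, Finset.mem_range, zero_add, mem_ofPred_eq] at hi hj
    have hi' := (hr i hi.2).1
    have hj' := (hr j hj.2).1
    rw [hij] at hi'
    have key : ∀ a b : ℕ, (a : ℝ) * τ < ((b : ℝ) + 1) * τ → a ≤ b := by
      intro a b h
      have : (a : ℝ) < ((b + 1 : ℕ) : ℝ) := by
        push_cast; exact lt_of_mul_lt_mul_right h hτ.le
      have := Nat.cast_lt.1 this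
      omega
    exact le_antisymm (key i j (hi'.1.trans_le hj'.2)) (key j i (hj'.1.trans_le hi'.2))
  rw [← Finset.card_image_of_injOn hinj, ← ncard_coe_finset, numSwitches]
  refine ncard_le_ncard ?_ (hσ.finite_switches _)
  intro s hs
  simp only [Finset.coe_image, Finset.coe_filter, mem_image, Finset.mem_range, zero_add,
    mem_ofPred_eq] at hs
  obtain ⟨i, ⟨him, hi⟩, rfl⟩ := hs
  obtain ⟨h1, h2⟩ := hr i hi
  refine ⟨⟨?_, ?_⟩, h2⟩
  · exact le_trans (by positivity) h1.1.le
  · have : ((i : ℝ) + 1) ≤ m := by exact_mod_cast him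
    nlinarith [h1.2]

end switchCount

/-! ### From exponential bounds to a class-K function. -/

theorem isClassK_add_rpow {C₁ C₂ : NNReal} (hC₁ : 0 < C₁) {β γ : ℝ} (hβ : 0 < β)
    (hγ : 0 < γ) : IsClassK fun r => C₁ * r ^ β + C₂ * r ^ γ := by
  refine ⟨?_, ?_, ?_⟩
  · intro r s hrs
    have h1 := NNReal.rpow_lt_rpow hrs hβ
    have h2 := (NNReal.rpow_lt_rpow hrs hγ).le
    exact add_lt_add_of_lt_of_le (mul_lt_mul_of_pos_left h1 hC₁) (mul_le_mul_right h2 C₂)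
  · exact (continuous_const.mul (NNReal.continuous_rpow_const hβ.le)).add
      (continuous_const.mul (NNReal.continuous_rpow_const hγ.le))
  · simp [NNReal.zero_rpow hβ.ne', NNReal.zero_rpow hγ.ne']

/-- A uniform exponential bound can be made to vanish with the size `r` of the initial state if
small initial states grow at most exponentially for a time proportional to `log (1 / r)`. -/
theorem exists_isClassK_of_exp_bounds {ν lam c α T C : ℝ} (hν : 0 ≤ ν) (hlam : 0 < lam)
    (hc : 0 < c) (hα : 0 < α) (hα1 : α < 1) (hT : 0 < T) (hC : 0 < C) :
    ∃ g : NNReal → NNReal, IsClassK g ∧ ∀ (r : NNReal) (t y : ℝ), 0 ≤ t → 0 ≤ y →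
      y ≤ C * Real.exp (-(2 * lam) * t) →
      ((r : ℝ) ≤ c * α ^ ⌊t / T⌋₊ → y ≤ Real.exp (ν * t) * r) →
      y ≤ (g r : ℝ) * Real.exp (-lam * t) := by
  -- β solves νβ - 2λ(1 - β) = -λ, the exponent of the interpolated bound; γ is chosen so that
  -- α^(γt/T) = e^{-λt}.
  set β : ℝ := lam / (ν + 2 * lam) with hβ
  set γ : ℝ := lam * T / -Real.log α with hγ
  have hden : 0 < ν + 2 * lam := by positivity
  have hβ0 : 0 < β := by positivity
  have hβ1 : β < 1 := by rw [hβ, div_lt_one hden]; linarith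
  have hlog : 0 < -Real.log α := neg_pos.2 (Real.log_neg hα hα1)
  have hγ0 : 0 < γ := by positivity
  refine ⟨fun r => (C.toNNReal ^ (1 - β)) * r ^ β + (C.toNNReal * (c.toNNReal⁻¹) ^ γ) * r ^ γ,
    isClassK_add_rpow (NNReal.rpow_pos (Real.toNNReal_pos.2 hC)) hβ0 hγ0, ?_⟩
  intro r t y ht hy hdecay hgrowth
  push_cast
  rw [Real.coe_toNNReal C hC.le, Real.coe_toNNReal c hc.le, add_mul]
  have hr : 0 ≤ (r : ℝ) := r.2
  have hA : 0 ≤ C ^ (1 - β) * (r : ℝ) ^ β * Real.exp (-lam * t) := by positivity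
  have hB : 0 ≤ C * (c⁻¹) ^ γ * (r : ℝ) ^ γ * Real.exp (-lam * t) := by positivity
  by_cases hcase : (r : ℝ) ≤ c * α ^ ⌊t / T⌋₊
  · refine le_trans ?_ (le_add_of_nonneg_right hB)
    have h1 := hgrowth hcase
    have h2 : y = y ^ β * y ^ (1 - β) := by
      rw [← Real.rpow_add_of_nonneg hy hβ0.le (by linarith)]
      simp
    rw [h2]
    refine (mul_le_mul (Real.rpow_le_rpow hy h1 hβ0.le)
      (Real.rpow_le_rpow hy hdecay (by linarith)) (by positivity) (by positivity)).trans ?_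
    rw [Real.mul_rpow (Real.exp_nonneg _) hr, Real.mul_rpow hC.le (Real.exp_nonneg _),
      ← Real.exp_mul, ← Real.exp_mul]
    have h3 : Real.exp (ν * t * β) * Real.exp (-(2 * lam) * t * (1 - β)) = Real.exp (-lam * t) := by
      rw [← Real.exp_add]
      congr 1
      have : β * (ν + 2 * lam) = lam := by rw [hβ]; field_simp
      linear_combination t * this
    rw [← h3]
    apply le_of_eq
    ring
  -- Here r exceeds cα^⌊t/T⌋, so one of the two factors e^{-λt} can be traded for a power of r/c.
  · refine le_trans ?_ (le_add_of_nonneg_left hA)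
    push Not at hcase
    have h1 : Real.exp (-lam * t) ≤ (c⁻¹ * (r : ℝ)) ^ γ := by
      have h2 : α ^ ⌊t / T⌋₊ ≤ c⁻¹ * r := by
        rw [inv_mul_eq_div, le_div_iff₀ hc, mul_comm]
        exact hcase.le
      refine le_trans ?_ (Real.rpow_le_rpow (by positivity) h2 hγ0.le)
      rw [← Real.rpow_natCast, ← Real.rpow_mul hα.le, Real.rpow_def_of_pos hα, Real.exp_le_exp]
      have h3 : Real.log α * γ = -(lam * T) := by
        rw [hγ]
        field_simp [hlog.ne', (neg_pos.1 hlog).ne]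
      have h4 : (⌊t / T⌋₊ : ℝ) * T ≤ t := by
        rw [← le_div_iff₀ hT]
        exact Nat.floor_le (div_nonneg ht hT.le)
      have h5 : Real.log α * (⌊t / T⌋₊ * γ) = -(lam * (⌊t / T⌋₊ * T)) := by
        linear_combination (⌊t / T⌋₊ : ℝ) * h3
      rw [h5]
      nlinarith
    rw [Real.mul_rpow (by positivity) hr] at h1
    calc y ≤ C * Real.exp (-(2 * lam) * t) := hdecay
      _ = C * Real.exp (-lam * t) * Real.exp (-lam * t) := by
        rw [mul_assoc, ← Real.exp_add]; congr 2; ring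
      _ ≤ C * (c⁻¹ ^ γ * (r : ℝ) ^ γ) * Real.exp (-lam * t) := by gcongr
      _ = _ := by ring

/-! ### Block alphabets and their data rate. -/

/-- Symbols consisting of a mode and a message in `Q`, the message being trivial except at the
multiples of `n`. -/
def BlockAlphabet (N n : ℕ) {Q : Type} (q₀ : Q) (k : ℕ) : Type :=
  {s : Fin N × Q // n ∣ k ∨ s.2 = q₀}

theorem nat_card_blockAlphabet (N n : ℕ) {Q : Type} [Fintype Q] (q₀ : Q) (k : ℕ) :
    Nat.card (BlockAlphabet N n q₀ k) = if n ∣ k then N * Fintype.card Q else N := by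
  unfold BlockAlphabet
  split_ifs with h
  · rw [Nat.card_congr (Equiv.subtypeUnivEquiv fun _ => Or.inl h), Nat.card_prod]
    simp
  · have e : {s : Fin N × Q // n ∣ k ∨ s.2 = q₀} ≃ Fin N :=
      { toFun := fun s => s.1.1
        invFun := fun i => ⟨(i, q₀), Or.inr rfl⟩
        left_inv := fun s => by
          obtain ⟨⟨i, q⟩, hs⟩ := s
          have : q = q₀ := hs.resolve_left h
          simp [this]
        right_inv := fun _ => rfl }
    rw [Nat.card_congr e]
    simp

instance {N n : ℕ} {Q : Type} [Finite Q] {q₀ : Q} {k : ℕ} : Finite (BlockAlphabet N n q₀ k) :=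
  inferInstanceAs (Finite {s : Fin N × Q // n ∣ k ∨ s.2 = q₀})

/-- The coder–controller that sends the symbols `enc X S k`, where `X` and `S` are the sampled states
and modes, and applies the inputs `inp s k` on `[T_k, T_{k+1})`, where `s` is the sequence of
symbols. Sequences are continued as constants beyond the current time. -/
noncomputable def blockCoderController {d c N : ℕ} {τs : ℝ} (n : ℕ) {Q : Type} [Finite Q] (q₀ : Q)
    (enc : (ℕ → EuclideanSpace ℝ (Fin d)) → (ℕ → Fin N) → ℕ → Fin N × Q)
    (henc : ∀ X S k, n ∣ k ∨ (enc X S k).2 = q₀)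
    (inp : (ℕ → Fin N × Q) → ℕ → ℝ → EuclideanSpace ℝ (Fin c))
    (hinp : ∀ s k, IntegrableOn (inp s k) (Ico ((k : ℝ) * τs) (((k : ℝ) + 1) * τs)) volume) :
    CoderController d c N τs where
  Alphabet := BlockAlphabet N n q₀
  fintypeAlphabet _ := Fintype.ofFinite _
  coder k X S := ⟨enc (fun j => X ⟨min j k, by omega⟩) (fun j => S ⟨min j k, by omega⟩) k,
    henc _ _ _⟩
  controller k e := inp (fun j => (e ⟨min j k, by omega⟩).1) k
  integrable k e := hinp _ _

section blockCoderController

variable {d c N : ℕ} {τs : ℝ} {n : ℕ} {Q : Type} {q₀ : Q}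

/-- By causality the artificial continuation of the histories has no influence, so one may reason
with the full sequences of samples. -/
theorem exists_input_of_isTrajectory_block [Finite Q]
    {enc : (ℕ → EuclideanSpace ℝ (Fin d)) → (ℕ → Fin N) → ℕ → Fin N × Q}
    {henc : ∀ X S k, n ∣ k ∨ (enc X S k).2 = q₀}
    {inp : (ℕ → Fin N × Q) → ℕ → ℝ → EuclideanSpace ℝ (Fin c)}
    {hinp : ∀ s k, IntegrableOn (inp s k) (Ico ((k : ℝ) * τs) (((k : ℝ) + 1) * τs)) volume}
    (henc_causal : ∀ X X' S S' k, (∀ j ≤ k, X j = X' j) → (∀ j ≤ k, S j = S' j) →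
      enc X S k = enc X' S' k)
    (hinp_causal : ∀ s s' k, (∀ j ≤ k, s j = s' j) → inp s k = inp s' k)
    {A : Fin N → Matrix (Fin d) (Fin d) ℝ} {B : Fin N → Matrix (Fin d) (Fin c) ℝ}
    {σ : ℝ → Fin N} {x : ℝ → EuclideanSpace ℝ (Fin d)}
    (hx : (blockCoderController n q₀ enc henc inp hinp).IsTrajectory A B σ x) :
    ∃ u : ℝ → EuclideanSpace ℝ (Fin c),
      (∀ k : ℕ, EqOn u (inp (enc (fun j => x (j * τs)) (fun j => σ (j * τs))) k)
        (Ico ((k : ℝ) * τs) (((k : ℝ) + 1) * τs))) ∧ IsSolution A B σ u x := by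
  obtain ⟨u, hu, hsol⟩ := hx
  refine ⟨u, fun k => ?_, hsol⟩
  have hsym : ∀ j, ((blockCoderController n q₀ enc henc inp hinp).symbol x σ j).1 =
      enc (fun j => x (j * τs)) (fun j => σ (j * τs)) j := by
    intro j
    refine henc_causal _ _ _ _ j (fun l hl => ?_) fun l hl => ?_ <;>
      simp [min_eq_left hl]
  have hctl : (blockCoderController n q₀ enc henc inp hinp).controller k
      (fun j => (blockCoderController n q₀ enc henc inp hinp).symbol x σ j) =
      inp (enc (fun j => x (j * τs)) (fun j => σ (j * τs))) k := by
    refine hinp_causal _ _ k fun j hj => ?_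
    refine (hsym (min j k)).trans ?_
    rw [min_eq_left hj]
  rw [← hctl]
  exact hu k

theorem sum_range_dvd_indicator (hn : 0 < n) (k : ℕ) :
    (∑ j ∈ Finset.range k, if n ∣ j then 1 else 0) = (k + n - 1) / n := by
  induction k with
  | zero => simp [Nat.div_eq_of_lt (Nat.sub_lt hn one_pos)]
  | succ k ih =>
    rw [Finset.sum_range_succ, ih]
    have h1 : k + 1 + n - 1 = (k + n - 1) + 1 := by omega
    rw [h1, Nat.succ_div]
    have h2 : k + n - 1 + 1 = k + n := by omega
    rw [h2]
    simp

theorem tendsto_sum_range_dvd_indicator_div (hn : 0 < n) :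
    Tendsto (fun k : ℕ => ((∑ j ∈ Finset.range k, if n ∣ j then 1 else 0 : ℕ) : ℝ) / k) atTop
      (𝓝 (1 / n)) := by
  have hn' : (0 : ℝ) < n := Nat.cast_pos.2 hn
  have hlim : Tendsto (fun k : ℕ => (1 : ℝ) / n + 1 / k) atTop (𝓝 (1 / n)) := by
    simpa using tendsto_const_nhds.add (tendsto_one_div_atTop_nhds_zero_nat (𝕜 := ℝ))
  refine tendsto_of_tendsto_of_tendsto_of_le_of_le' tendsto_const_nhds hlim ?_ ?_
  · filter_upwards [eventually_gt_atTop 0] with k hk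
    have hk' : (0 : ℝ) < k := Nat.cast_pos.2 hk
    rw [sum_range_dvd_indicator hn, div_le_div_iff₀ hn' hk', one_mul]
    have : k ≤ (k + n - 1) / n * n := by
      have h1 := Nat.div_add_mod (k + n - 1) n
      have h2 := Nat.mod_lt (k + n - 1) hn
      have h3 : n * ((k + n - 1) / n) = (k + n - 1) / n * n := Nat.mul_comm _ _
      omega
    exact_mod_cast this
  · filter_upwards [eventually_gt_atTop 0] with k hk
    have hk' : (0 : ℝ) < k := Nat.cast_pos.2 hk
    rw [sum_range_dvd_indicator hn, div_add_div _ _ hn'.ne' hk'.ne',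
      div_le_div_iff₀ hk' (by positivity)]
    have : (k + n - 1) / n * n ≤ k + n := (Nat.div_mul_le_self _ _).trans (by omega)
    have h2 : (((k + n - 1) / n : ℕ) : ℝ) * n ≤ k + n := by exact_mod_cast this
    nlinarith

theorem dataRate_eq_of_card {C : CoderController d c N τs} (hN : 0 < N) (hn : 0 < n)
    {M : ℕ} (hM : 0 < M)
    (hC : ∀ k, Nat.card (C.Alphabet k) = if n ∣ k then N * M else N) :
    C.dataRate = (((1 / τs) * ((1 / n) * Real.logb 2 M + Real.logb 2 N) : ℝ) : EReal) := by
  have hN' : (N : ℝ) ≠ 0 := (Nat.cast_pos.2 hN).ne'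
  have hM' : (M : ℝ) ≠ 0 := (Nat.cast_pos.2 hM).ne'
  have hlog : ∀ j, Real.logb 2 (@Fintype.card (C.Alphabet j) (C.fintypeAlphabet j) : ℝ) =
      Real.logb 2 N + ((if n ∣ j then 1 else 0 : ℕ) : ℝ) * Real.logb 2 M := by
    intro j
    rw [← @Nat.card_eq_fintype_card _ (C.fintypeAlphabet j), hC j]
    split_ifs with h
    · push_cast
      rw [Real.logb_mul hN' hM', one_mul]
    · simp
  refine Tendsto.limsup_eq ((continuous_coe_real_ereal.tendsto _).comp ?_)
  have hlim : Tendsto (fun k : ℕ => (1 / τs) *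
      (((∑ j ∈ Finset.range k, if n ∣ j then 1 else 0 : ℕ) : ℝ) / k * Real.logb 2 M +
        Real.logb 2 N)) atTop (𝓝 ((1 / τs) * ((1 / n) * Real.logb 2 M + Real.logb 2 N))) :=
    (((tendsto_sum_range_dvd_indicator_div hn).mul_const _).add_const _).const_mul _
  refine hlim.congr' ?_
  filter_upwards [eventually_gt_atTop 0] with k hk
  have hk' : (k : ℝ) ≠ 0 := (Nat.cast_pos.2 hk).ne'
  simp only [hlog]
  rw [Finset.sum_add_distrib, Finset.sum_const, Finset.card_range, nsmul_eq_mul,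
    ← Finset.sum_mul, ← Nat.cast_sum]
  field_simp
  ring


end blockCoderController

/-- The block length T = nτs is fixed first, so large that the term with `D` alone lies below the
right-hand side. Half of the gap goes to α; the other half absorbs the mismatch term, which is of
order 1/n for fixed T. -/
theorem exists_admissibleParameters {d c N : ℕ} (A : Fin N → Matrix (Fin d) (Fin d) ℝ)
    (B : Fin N → Matrix (Fin d) (Fin c) ℝ)
    (φ : EuclideanSpace ℝ (Fin d) → Fin N → EuclideanSpace ℝ (Fin c))
    {D μ₁ μ₂ τa : ℝ} (hτa : 0 < τa) (hμ : μ₁ / τa < μ₂) :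
    ∃ (τs α : ℝ) (n : ℕ), AdmissibleParameters A B φ D μ₁ μ₂ τa τs α n := by
  obtain ⟨T, hT, hgap⟩ : ∃ T : ℝ, 0 < T ∧ D * Real.exp (-μ₂ * T) < Real.exp (-μ₁ * T / τa) := by
    have h1 : Tendsto (fun T : ℝ => D * Real.exp (-((μ₂ - μ₁ / τa) * T))) atTop (𝓝 (D * 0)) :=
      (Real.tendsto_exp_neg_atTop_nhds_zero.comp
        (tendsto_id.const_mul_atTop (sub_pos.2 hμ))).const_mul D
    rw [mul_zero] at h1
    obtain ⟨T, hT1, hT0⟩ :=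
      ((h1.eventually_lt_const one_pos).and (eventually_gt_atTop 0)).exists
    refine ⟨T, hT0, ?_⟩
    have h2 : Real.exp (-μ₂ * T) =
        Real.exp (-((μ₂ - μ₁ / τa) * T)) * Real.exp (-μ₁ * T / τa) := by
      rw [← Real.exp_add]; congr 1; field_simp; ring
    rw [h2, ← mul_assoc]
    exact mul_lt_of_lt_one_left (Real.exp_pos _) hT1
  set gap := Real.exp (-μ₁ * T / τa) - D * Real.exp (-μ₂ * T) with hgapdef
  have hgap0 : 0 < gap := sub_pos.2 hgap
  set E := Real.exp (growthRate A * T) with hE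
  have hE0 : 0 < E := Real.exp_pos _
  set Δ := modeSpread A + modeSpread B * feedbackGain φ with hΔ
  have hlim : Tendsto (fun n : ℕ => E * (T / τa) * D * Δ * T * (1 / (n : ℝ))) atTop
      (𝓝 (E * (T / τa) * D * Δ * T * 0)) :=
    tendsto_one_div_atTop_nhds_zero_nat.const_mul _
  rw [mul_zero] at hlim
  obtain ⟨n, hn, hn1⟩ := ((hlim.eventually_lt_const (half_pos hgap0)).and
    (eventually_ge_atTop 1)).exists
  have hn0 : (0 : ℝ) < n := Nat.cast_pos.2 hn1
  have hnT : (n : ℝ) * (T / n) = T := by field_simp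
  refine ⟨T / n, gap / (2 * E), n, div_pos hT hn0, by positivity, hn1, ?_⟩
  rw [hnT]
  have h1 : E * (gap / (2 * E)) = gap / 2 := by field_simp
  have h2 : E * (T / n) * (T / τa) * D * Δ = E * (T / τa) * D * Δ * T * (1 / (n : ℝ)) := by ring
  rw [h1, h2]
  linarith

/-! ### Error estimates over one block. -/

section window

variable {d c N : ℕ} {A : Fin N → Matrix (Fin d) (Fin d) ℝ}
  {B : Fin N → Matrix (Fin d) (Fin c) ℝ}
  {φ : EuclideanSpace ℝ (Fin d) → Fin N → EuclideanSpace ℝ (Fin c)} {D μ₁ μ₂ : ℝ}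

/-- Sampling can miss switches but cannot invent them. -/
theorem IsSwitchingSignal.card_sample_changes_le {σ : ℝ → Fin N} (hσ : IsSwitchingSignal σ)
    {τ : ℝ} (hτ : 0 < τ) (k₀ n : ℕ) :
    ((Finset.range n).filter fun l => σ ((k₀ + l : ℕ) * τ) ≠ σ ((k₀ + (l + 1) : ℕ) * τ)).card
      ≤ windowCount σ τ k₀ n := by
  classical
  rw [windowCount, ← Finset.card_filter]
  refine Finset.card_le_card fun l hl => ?_
  rw [Finset.mem_filter] at hl ⊢
  refine ⟨hl.1, ?_⟩
  by_contra hcon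
  refine hl.2 (hσ.eq_of_not_switchesIn hτ.le hcon _ ⟨?_, ?_⟩).symm <;> push_cast <;> nlinarith

/-- The data of one coding block: the system is driven on `n` sampling intervals, starting at time
`k₀ τ`, by the input that the feedback generates along the closed-loop solution from `z` with the
sampled modes. -/
structure IsBlockRun (hφ : IsStabilizingFeedback A B φ D μ₁ μ₂) (σ : ℝ → Fin N)
    (u : ℝ → EuclideanSpace ℝ (Fin c)) (x : ℝ → EuclideanSpace ℝ (Fin d)) (τ : ℝ) (k₀ n : ℕ)
    (z : EuclideanSpace ℝ (Fin d)) : Prop where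
  switching : IsSwitchingSignal σ
  solution : IsSolution A B σ u x
  period_pos : 0 < τ
  input : ∀ i < n, ∀ s ∈ Ico 0 τ, u ((k₀ + i : ℕ) * τ + s) =
    φ (hφ.modeSol (σ ((k₀ + i : ℕ) * τ))
      (hφ.gridState τ (fun l => σ ((k₀ + l : ℕ) * τ)) z i) s) (σ ((k₀ + i : ℕ) * τ))

namespace IsBlockRun

variable {hφ : IsStabilizingFeedback A B φ D μ₁ μ₂} {σ : ℝ → Fin N}
  {u : ℝ → EuclideanSpace ℝ (Fin c)} {x : ℝ → EuclideanSpace ℝ (Fin d)} {τ : ℝ} {k₀ n : ℕ}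
  {z : EuclideanSpace ℝ (Fin d)}

theorem norm_modeSol_le (h : IsBlockRun hφ σ u x τ k₀ n z) (hD : 0 ≤ D) (hμ₁ : 0 ≤ μ₁)
    {i : ℕ} (hi : i < n) {s : ℝ} (hs : s ∈ Icc 0 τ) :
    ‖hφ.modeSol (σ ((k₀ + i : ℕ) * τ))
      (hφ.gridState τ (fun l => σ ((k₀ + l : ℕ) * τ)) z i) s‖ ≤
      D * ‖z‖ * Real.exp (μ₁ * windowCount σ τ k₀ n - μ₂ * (i * τ + s)) := by
  have hτ := h.period_pos
  have hin : ((i : ℝ) + 1) ≤ n := by exact_mod_cast hi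
  have h1 := hφ.norm_stepSol_le hτ (fun l => σ ((k₀ + l : ℕ) * τ)) z hD hμ₁
    (h.switching.card_sample_changes_le hτ k₀ n) (t := i * τ + s)
    (add_nonneg (by positivity) hs.1) (by nlinarith [hs.2])
  rw [hφ.stepSol_eq hτ _ _ (k := i) ⟨by linarith [hs.1], by linarith [hs.2]⟩] at h1
  simpa using h1

/-- The bound on the mismatch between the two vector fields in windows with a switch. -/
noncomputable def mismatch (A : Fin N → Matrix (Fin d) (Fin d) ℝ)
    (B : Fin N → Matrix (Fin d) (Fin c) ℝ)
    (φ : EuclideanSpace ℝ (Fin d) → Fin N → EuclideanSpace ℝ (Fin c)) (D μ₁ r : ℝ) (p : ℕ) : ℝ :=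
  (modeSpread A + modeSpread B * feedbackGain φ) * (D * r * Real.exp (μ₁ * p))

theorem spread_nonneg (A : Fin N → Matrix (Fin d) (Fin d) ℝ) (B : Fin N → Matrix (Fin d) (Fin c) ℝ)
    (φ : EuclideanSpace ℝ (Fin d) → Fin N → EuclideanSpace ℝ (Fin c)) :
    0 ≤ modeSpread A + modeSpread B * feedbackGain φ :=
  add_nonneg (modeSpread_nonneg A) (mul_nonneg (modeSpread_nonneg B) (feedbackGain_nonneg φ))

theorem mismatch_nonneg (hD : 0 ≤ D) {r : ℝ} (hr : 0 ≤ r) (p : ℕ) :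
    0 ≤ mismatch A B φ D μ₁ r p :=
  mul_nonneg (spread_nonneg A B φ) (by positivity)

/-- Without a switch in the window, both systems have the same mode and input and the error only
grows exponentially; a switch adds at most τ times the mismatch. Charging each addition the full
exponential factor is an overestimate, valid because ν ≥ 0. -/
theorem norm_sub_modeSol_le_of_grid (h : IsBlockRun hφ σ u x τ k₀ n z) (hD : 0 ≤ D) (hμ₁ : 0 ≤ μ₁)
    (hμ₂ : 0 ≤ μ₂) (hν : 0 ≤ growthRate A) {i : ℕ} (hi : i < n) {E₀ : ℝ}
    (hgrid : ‖x ((k₀ + i : ℕ) * τ) - hφ.gridState τ (fun l => σ ((k₀ + l : ℕ) * τ)) z i‖ ≤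
      Real.exp (growthRate A * (i * τ)) *
        (E₀ + windowCount σ τ k₀ i * τ * mismatch A B φ D μ₁ ‖z‖ (windowCount σ τ k₀ n)))
    {s : ℝ} (hs : s ∈ Icc 0 τ) :
    ‖x ((k₀ + i : ℕ) * τ + s) - hφ.modeSol (σ ((k₀ + i : ℕ) * τ))
      (hφ.gridState τ (fun l => σ ((k₀ + l : ℕ) * τ)) z i) s‖ ≤
      Real.exp (growthRate A * (i * τ + s)) *
        (E₀ + windowCount σ τ k₀ (i + 1) * τ *
          mismatch A B φ D μ₁ ‖z‖ (windowCount σ τ k₀ n)) := by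
  classical
  have hτ := h.period_pos
  set M := mismatch A B φ D μ₁ ‖z‖ (windowCount σ τ k₀ n) with hM
  have hM0 : 0 ≤ M := mismatch_nonneg hD (norm_nonneg z) _
  -- The weight removes the mismatch from windows without a switch and is also the increment of
  -- `windowCount`.
  set w : ℝ := if SwitchesIn σ τ (k₀ + i) then 1 else 0 with hw
  have hw0 : 0 ≤ w := by rw [hw]; split_ifs <;> norm_num
  have hcount : (windowCount σ τ k₀ (i + 1) : ℝ) = windowCount σ τ k₀ i + w := by
    rw [windowCount, Finset.sum_range_succ, ← windowCount, hw]
    push_cast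
    rfl
  have hmain := h.solution.norm_sub_le (W := w * M) (τ := τ)
    (hφ.isSolution_modeSol (σ ((k₀ + i : ℕ) * τ))
      (hφ.gridState τ (fun l => σ ((k₀ + l : ℕ) * τ)) z i))
    (T₀ := (k₀ + i : ℕ) * τ) (by positivity)
    (fun s hs => h.input i hi s ⟨hs.1.le, hs.2⟩) (Or.inl hν) (by positivity) ?_ s hs
  · rw [hφ.modeSol_zero] at hmain
    refine hmain.trans ?_
    have hE : Real.exp (growthRate A * (i * τ + s)) =
        Real.exp (growthRate A * s) * Real.exp (growthRate A * (i * τ)) := by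
      rw [← Real.exp_add]; congr 1; ring
    rw [hE, mul_assoc, hcount]
    refine mul_le_mul_of_nonneg_left ?_ (Real.exp_nonneg _)
    have h1 : 1 ≤ Real.exp (growthRate A * (i * τ)) := Real.one_le_exp (by positivity)
    have h2 : s * (w * M) ≤ τ * (w * M) := mul_le_mul_of_nonneg_right hs.2 (by positivity)
    have h3 : τ * (w * M) ≤ Real.exp (growthRate A * (i * τ)) * (τ * (w * M)) :=
      le_mul_of_one_le_left (by positivity) h1
    linarith
  · intro r hr
    by_cases hsw : SwitchesIn σ τ (k₀ + i)
    · right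
      have hw1 : w = 1 := by rw [hw, if_pos hsw]
      rw [hw1, one_mul]
      have hv := h.norm_modeSol_le hD hμ₁ hi (Ioo_subset_Icc_self hr)
      have hv' := hv.trans (mul_le_mul_of_nonneg_left (Real.exp_le_exp.2 (sub_le_self _
        (mul_nonneg hμ₂ (add_nonneg (by positivity) hr.1.le)))) (by positivity))
      have hv'' := hφ.norm_le (hφ.modeSol (σ ((k₀ + i : ℕ) * τ))
        (hφ.gridState τ (fun l => σ ((k₀ + l : ℕ) * τ)) z i) r) (σ ((k₀ + i : ℕ) * τ))
      refine (add_le_add le_rfl (mul_le_mul_of_nonneg_left hv'' (modeSpread_nonneg B))).trans ?_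
      rw [← mul_assoc, ← add_mul]
      exact mul_le_mul_of_nonneg_left hv' (spread_nonneg A B φ)
    · left
      refine h.switching.eq_of_not_switchesIn hτ.le hsw _ ⟨by linarith [hr.1], ?_⟩
      linarith [hr.2]

theorem norm_sub_gridState_le (h : IsBlockRun hφ σ u x τ k₀ n z) (hD : 0 ≤ D) (hμ₁ : 0 ≤ μ₁)
    (hμ₂ : 0 ≤ μ₂) (hν : 0 ≤ growthRate A) {i : ℕ} (hi : i ≤ n) :
    ‖x ((k₀ + i : ℕ) * τ) - hφ.gridState τ (fun l => σ ((k₀ + l : ℕ) * τ)) z i‖ ≤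
      Real.exp (growthRate A * (i * τ)) * (‖x (k₀ * τ) - z‖ +
        windowCount σ τ k₀ i * τ * mismatch A B φ D μ₁ ‖z‖ (windowCount σ τ k₀ n)) := by
  induction i with
  | zero => simp [windowCount, IsStabilizingFeedback.gridState]
  | succ i ih =>
    have hτ := h.period_pos
    have := h.norm_sub_modeSol_le_of_grid hD hμ₁ hμ₂ hν hi
      (ih (Nat.le_of_succ_le hi)) ⟨hτ.le, le_rfl⟩
    have e1 : ((k₀ + (i + 1) : ℕ) : ℝ) * τ = (k₀ + i : ℕ) * τ + τ := by push_cast; ring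
    have e2 : ((i + 1 : ℕ) : ℝ) * τ = i * τ + τ := by push_cast; ring
    rw [e1, e2]
    exact this

theorem norm_sub_modeSol_le (h : IsBlockRun hφ σ u x τ k₀ n z) (hD : 0 ≤ D) (hμ₁ : 0 ≤ μ₁)
    (hμ₂ : 0 ≤ μ₂) (hν : 0 ≤ growthRate A) {i : ℕ} (hi : i < n) {s : ℝ} (hs : s ∈ Icc 0 τ) :
    ‖x ((k₀ + i : ℕ) * τ + s) - hφ.modeSol (σ ((k₀ + i : ℕ) * τ))
      (hφ.gridState τ (fun l => σ ((k₀ + l : ℕ) * τ)) z i) s‖ ≤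
      Real.exp (growthRate A * (i * τ + s)) * (‖x (k₀ * τ) - z‖ +
        windowCount σ τ k₀ n * τ * mismatch A B φ D μ₁ ‖z‖ (windowCount σ τ k₀ n)) := by
  refine (h.norm_sub_modeSol_le_of_grid hD hμ₁ hμ₂ hν hi
    (h.norm_sub_gridState_le hD hμ₁ hμ₂ hν hi.le) hs).trans ?_
  have hM0 : 0 ≤ mismatch A B φ D μ₁ ‖z‖ (windowCount σ τ k₀ n) :=
    mismatch_nonneg hD (norm_nonneg z) _
  have hle : (windowCount σ τ k₀ (i + 1) : ℝ) ≤ windowCount σ τ k₀ n :=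
    Nat.cast_le.2 (windowCount_mono τ k₀ hi)
  have := h.period_pos
  gcongr

/-- The state at the end of a block. -/
theorem norm_end_le (h : IsBlockRun hφ σ u x τ k₀ n z) (hD : 0 ≤ D) (hμ₁ : 0 ≤ μ₁)
    (hμ₂ : 0 ≤ μ₂) (hν : 0 ≤ growthRate A) :
    ‖x ((k₀ + n : ℕ) * τ)‖ ≤
      D * ‖z‖ * Real.exp (μ₁ * windowCount σ τ k₀ n - μ₂ * (n * τ)) +
      Real.exp (growthRate A * (n * τ)) * (‖x (k₀ * τ) - z‖ +
        windowCount σ τ k₀ n * τ * mismatch A B φ D μ₁ ‖z‖ (windowCount σ τ k₀ n)) := by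
  have hτ := h.period_pos
  have h1 := h.norm_sub_gridState_le hD hμ₁ hμ₂ hν le_rfl
  have h2 := hφ.norm_stepSol_le hτ (fun l => σ ((k₀ + l : ℕ) * τ)) z hD hμ₁
    (h.switching.card_sample_changes_le hτ k₀ n) (t := n * τ) (by positivity) le_rfl
  rw [← hφ.gridState_eq_stepSol hτ] at h2
  have h3 := norm_add_le (hφ.gridState τ (fun l => σ ((k₀ + l : ℕ) * τ)) z n)
    (x ((k₀ + n : ℕ) * τ) - hφ.gridState τ (fun l => σ ((k₀ + l : ℕ) * τ)) z n)
  rw [add_sub_cancel] at h3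
  exact h3.trans (add_le_add h2 h1)

theorem exists_window (h : IsBlockRun hφ σ u x τ k₀ n z) {t : ℝ}
    (ht : t ∈ Ico (k₀ * τ) ((k₀ + n : ℕ) * τ)) :
    ∃ i < n, ∃ s ∈ Icc 0 τ, t = (k₀ + i : ℕ) * τ + s := by
  have hτ := h.period_pos
  have ht0 : 0 ≤ t := le_trans (by positivity) ht.1
  have hmem := mem_Ico_floor_div hτ ht0
  obtain ⟨k, hk⟩ : ∃ k, k = ⌊t / τ⌋₊ := ⟨_, rfl⟩
  rw [← hk] at hmem
  have h1 : k₀ ≤ k := by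
    have : (k₀ : ℝ) < ((k + 1 : ℕ) : ℝ) := by
      push_cast; exact lt_of_mul_lt_mul_right (ht.1.trans_lt hmem.2) hτ.le
    have := Nat.cast_lt.1 this
    omega
  have h2 : k < k₀ + n := Nat.cast_lt.1 (lt_of_mul_lt_mul_right (hmem.1.trans_lt ht.2) hτ.le)
  refine ⟨k - k₀, by omega, t - k * τ, ⟨by linarith [hmem.1], by linarith [hmem.2]⟩, ?_⟩
  rw [Nat.add_sub_cancel' h1]
  ring

/-- The state inside a block. -/
theorem norm_le (h : IsBlockRun hφ σ u x τ k₀ n z) (hD : 0 ≤ D) (hμ₁ : 0 ≤ μ₁)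
    (hμ₂ : 0 ≤ μ₂) (hν : 0 ≤ growthRate A) {t : ℝ}
    (ht : t ∈ Ico (k₀ * τ) ((k₀ + n : ℕ) * τ)) :
    ‖x t‖ ≤ D * ‖z‖ * Real.exp (μ₁ * windowCount σ τ k₀ n) +
      Real.exp (growthRate A * (n * τ)) * (‖x (k₀ * τ) - z‖ +
        windowCount σ τ k₀ n * τ * mismatch A B φ D μ₁ ‖z‖ (windowCount σ τ k₀ n)) := by
  have hτ := h.period_pos
  obtain ⟨i, hi, s, hs, rfl⟩ := h.exists_window ht
  have h1 := h.norm_sub_modeSol_le hD hμ₁ hμ₂ hν hi hs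
  have h2 := h.norm_modeSol_le hD hμ₁ hi hs
  have h3 := norm_add_le (hφ.modeSol (σ ((k₀ + i : ℕ) * τ))
      (hφ.gridState τ (fun l => σ ((k₀ + l : ℕ) * τ)) z i) s)
    (x ((k₀ + i : ℕ) * τ + s) - hφ.modeSol (σ ((k₀ + i : ℕ) * τ))
      (hφ.gridState τ (fun l => σ ((k₀ + l : ℕ) * τ)) z i) s)
  rw [add_sub_cancel] at h3
  have hin : ((i : ℝ) + 1) ≤ n := by exact_mod_cast hi
  have h4 : (i : ℝ) * τ + s ≤ n * τ := by nlinarith [hs.2]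
  have h5 : 0 ≤ (i : ℝ) * τ + s := add_nonneg (by positivity) hs.1
  have hM0 : 0 ≤ mismatch A B φ D μ₁ ‖z‖ (windowCount σ τ k₀ n) :=
    mismatch_nonneg hD (norm_nonneg z) _
  refine h3.trans (add_le_add (h2.trans ?_) (h1.trans ?_))
  · gcongr
    exact sub_le_self _ (mul_nonneg hμ₂ h5)
  · gcongr

/-- Without input the state grows at most with the rate `growthRate A`. -/
theorem norm_le_of_zero (h : IsBlockRun hφ σ u x τ k₀ n 0) (hD : 0 ≤ D) (hμ₁ : 0 ≤ μ₁)
    (hμ₂ : 0 ≤ μ₂) (hν : 0 ≤ growthRate A) {t : ℝ}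
    (ht : t ∈ Icc (k₀ * τ) ((k₀ + n : ℕ) * τ)) :
    ‖x t‖ ≤ Real.exp (growthRate A * (t - k₀ * τ)) * ‖x (k₀ * τ)‖ := by
  have hτ := h.period_pos
  rcases eq_or_lt_of_le ht.2 with heq | hlt
  · have := h.norm_sub_gridState_le hD hμ₁ hμ₂ hν le_rfl
    rw [hφ.gridState_of_zero hτ.le] at this
    have e : t - k₀ * τ = n * τ := by rw [heq]; push_cast; ring
    rw [e, heq]
    simpa [mismatch] using this
  · obtain ⟨i, hi, s, hs, rfl⟩ := h.exists_window ⟨ht.1, hlt⟩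
    have := h.norm_sub_modeSol_le hD hμ₁ hμ₂ hν hi hs
    rw [hφ.gridState_of_zero hτ.le, hφ.modeSol_of_zero _ hs.1] at this
    have e : ((k₀ + i : ℕ) : ℝ) * τ + s - k₀ * τ = i * τ + s := by push_cast; ring
    rw [e]
    simpa [mismatch] using this

end IsBlockRun

end window

/-! ### Coder and controller, and their synchronization. -/

/-- The parameters of a block coder: a quantizer of the unit ball, the factors by which the bound
on the state is multiplied, and the initial bound. -/
structure BlockDesign (d m : ℕ) where
  quant : EuclideanSpace ℝ (Fin d) → (Fin d → Fin (2 * m + 1))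
  point : (Fin d → Fin (2 * m + 1)) → EuclideanSpace ℝ (Fin d)
  factor : ℕ → ℝ
  radius : ℝ

/-- The messages sent at the beginning of a block: a quantization cell and the index of the factor
by which the bound is updated. -/
abbrev BlockMessage (d m n : ℕ) : Type := (Fin d → Fin (2 * m + 1)) × Fin (n + 1)

namespace BlockDesign

variable {d c N m : ℕ} (P : BlockDesign d m) (n : ℕ)

/-- The least index `p ≤ n` for which `ρ * factor p` bounds `y`. -/
noncomputable def pick (ρ : ℝ) (y : EuclideanSpace ℝ (Fin d)) : Fin (n + 1) :=
  ⟨min (sInf {p | ‖y‖ ≤ ρ * P.factor p}) n, by omega⟩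

/-- The bound on the sampled states that the coder maintains. -/
noncomputable def boundSeq (X : ℕ → EuclideanSpace ℝ (Fin d)) : ℕ → ℝ
  | 0 => P.radius
  | k + 1 => if n ∣ k + 1 then boundSeq X k * P.factor (P.pick n (boundSeq X k) (X (k + 1)))
      else boundSeq X k

/-- The symbols sent by the coder. -/
noncomputable def enc (X : ℕ → EuclideanSpace ℝ (Fin d)) (S : ℕ → Fin N) (k : ℕ) :
    Fin N × BlockMessage d m n :=
  (S k, if n ∣ k then (P.quant ((P.boundSeq n X k)⁻¹ • X k),
    -- For k = 0 the truncated subtraction is harmless: the controller ignores the first index,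
    -- since its bound starts at `radius`.
    P.pick n (P.boundSeq n X (k - 1)) (X k)) else 0)

/-- The bound maintained by the coder, computed from the symbols. -/
noncomputable def decBound (s : ℕ → Fin N × BlockMessage d m n) : ℕ → ℝ
  | 0 => P.radius
  | k + 1 => if n ∣ k + 1 then decBound s k * P.factor (s (k + 1)).2.2 else decBound s k

variable {A : Fin N → Matrix (Fin d) (Fin d) ℝ} {B : Fin N → Matrix (Fin d) (Fin c) ℝ}
  {φ : EuclideanSpace ℝ (Fin d) → Fin N → EuclideanSpace ℝ (Fin c)} {D μ₁ μ₂ : ℝ}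
  (hφ : IsStabilizingFeedback A B φ D μ₁ μ₂) (τ : ℝ)

/-- The state estimate computed from the symbols. -/
noncomputable def decState (s : ℕ → Fin N × BlockMessage d m n) : ℕ → EuclideanSpace ℝ (Fin d)
  | 0 => P.decBound n s 0 • P.point (s 0).2.1
  | k + 1 => if n ∣ k + 1 then P.decBound n s (k + 1) • P.point (s (k + 1)).2.1
      else hφ.modeSol (s k).1 (decState s k) τ

/-- The input generated from the symbols. -/
noncomputable def inp (s : ℕ → Fin N × BlockMessage d m n) (k : ℕ) (t : ℝ) :
    EuclideanSpace ℝ (Fin c) :=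
  φ (hφ.modeSol (s k).1 (P.decState n hφ τ s k) (t - k * τ)) (s k).1

theorem enc_trivial (X : ℕ → EuclideanSpace ℝ (Fin d)) (S : ℕ → Fin N) (k : ℕ) :
    n ∣ k ∨ (P.enc n X S k).2 = 0 := by
  by_cases h : n ∣ k
  · exact Or.inl h
  · exact Or.inr (if_neg h)

theorem integrableOn_inp (hτ : 0 ≤ τ) (s : ℕ → Fin N × BlockMessage d m n) (k : ℕ) :
    IntegrableOn (P.inp n hφ τ s k) (Ico ((k : ℝ) * τ) (((k : ℝ) + 1) * τ)) volume := by
  have h := (intervalIntegrable_iff_integrableOn_Icc_of_le hτ).2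
    (hφ.integrableOn_feedback_modeSol (s k).1 (P.decState n hφ τ s k) hτ)
  have h' := h.comp_sub_right (k * τ)
  have hle : (k : ℝ) * τ ≤ ((k : ℝ) + 1) * τ := by nlinarith
  have e : τ + k * τ = ((k : ℝ) + 1) * τ := by ring
  rw [zero_add, e] at h'
  exact (intervalIntegrable_iff_integrableOn_Ico_of_le hle).1 h'

theorem boundSeq_congr {X X' : ℕ → EuclideanSpace ℝ (Fin d)} {k : ℕ} (h : ∀ j ≤ k, X j = X' j) :
    P.boundSeq n X k = P.boundSeq n X' k := by
  induction k with
  | zero => rfl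
  | succ k ih =>
    rw [boundSeq, boundSeq, ih fun j hj => h j (Nat.le_succ_of_le hj), h (k + 1) le_rfl]

theorem enc_congr (X X' : ℕ → EuclideanSpace ℝ (Fin d)) (S S' : ℕ → Fin N) (k : ℕ)
    (hX : ∀ j ≤ k, X j = X' j) (hS : ∀ j ≤ k, S j = S' j) :
    P.enc n X S k = P.enc n X' S' k := by
  rw [enc, enc, P.boundSeq_congr n hX, hX k le_rfl, hS k le_rfl,
    P.boundSeq_congr n fun j hj => hX j (hj.trans (Nat.sub_le k 1))]

theorem decBound_congr {s s' : ℕ → Fin N × BlockMessage d m n} {k : ℕ}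
    (h : ∀ j ≤ k, s j = s' j) : P.decBound n s k = P.decBound n s' k := by
  induction k with
  | zero => rfl
  | succ k ih =>
    rw [decBound, decBound, ih fun j hj => h j (Nat.le_succ_of_le hj), h (k + 1) le_rfl]

theorem decState_congr {s s' : ℕ → Fin N × BlockMessage d m n} {k : ℕ}
    (h : ∀ j ≤ k, s j = s' j) : P.decState n hφ τ s k = P.decState n hφ τ s' k := by
  induction k with
  | zero => rw [decState, decState, P.decBound_congr n h, h 0 le_rfl]
  | succ k ih =>
    rw [decState, decState, ih fun j hj => h j (Nat.le_succ_of_le hj), h (k + 1) le_rfl,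
      h k (Nat.le_succ k), P.decBound_congr n h]

theorem inp_congr (s s' : ℕ → Fin N × BlockMessage d m n) (k : ℕ) (h : ∀ j ≤ k, s j = s' j) :
    P.inp n hφ τ s k = P.inp n hφ τ s' k := by
  funext t
  rw [inp, inp, P.decState_congr n hφ τ h, h k le_rfl]

theorem decBound_enc (X : ℕ → EuclideanSpace ℝ (Fin d)) (S : ℕ → Fin N) (k : ℕ) :
    P.decBound n (P.enc n X S) k = P.boundSeq n X k := by
  induction k with
  | zero => rfl
  | succ k ih =>
    rw [decBound, boundSeq, ih]
    split_ifs with h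
    · simp [enc, h]
    · rfl

theorem boundSeq_block_add (X : ℕ → EuclideanSpace ℝ (Fin d)) (j : ℕ) {i : ℕ}
    (hi : i < n) : P.boundSeq n X (j * n + i) = P.boundSeq n X (j * n) := by
  induction i with
  | zero => rfl
  | succ i ih =>
    rw [← add_assoc, boundSeq, if_neg, ih (by omega)]
    rw [add_assoc, Nat.dvd_add_right (Dvd.intro_left j rfl)]
    exact Nat.not_dvd_of_pos_of_lt i.succ_pos hi

theorem boundSeq_block_succ (hn : 0 < n) (X : ℕ → EuclideanSpace ℝ (Fin d)) (j : ℕ) :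
    P.boundSeq n X ((j + 1) * n) = P.boundSeq n X (j * n) *
      P.factor (P.pick n (P.boundSeq n X (j * n)) (X ((j + 1) * n))) := by
  obtain ⟨l, rfl⟩ : ∃ l, n = l + 1 := ⟨n - 1, by omega⟩
  have e : (j + 1) * (l + 1) = j * (l + 1) + l + 1 := by ring
  rw [e, boundSeq, if_pos ⟨j + 1, by ring⟩, P.boundSeq_block_add (l + 1) X j (Nat.lt_succ_self l)]

/-- The quantized state at the beginning of block `j`. -/
noncomputable def blockStart (X : ℕ → EuclideanSpace ℝ (Fin d)) (j : ℕ) :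
    EuclideanSpace ℝ (Fin d) :=
  P.boundSeq n X (j * n) • P.point (P.quant ((P.boundSeq n X (j * n))⁻¹ • X (j * n)))

/-- The symbols contain all that the simulation needs, so the controller's estimate inside a block
is the simulated state. -/
theorem decState_enc (X : ℕ → EuclideanSpace ℝ (Fin d)) (S : ℕ → Fin N) (j : ℕ)
    {i : ℕ} (hi : i < n) :
    P.decState n hφ τ (P.enc n X S) (j * n + i) =
      hφ.gridState τ (fun l => S (j * n + l)) (P.blockStart n X j) i := by
  induction i with
  | zero =>
    have hstart : ∀ k, n ∣ k → P.decState n hφ τ (P.enc n X S) k =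
        P.boundSeq n X k • P.point (P.quant ((P.boundSeq n X k)⁻¹ • X k)) := by
      intro k hk
      rcases k with _ | k
      · rw [decState, decBound_enc]
        simp [enc]
      · rw [decState, if_pos hk, decBound_enc]
        simp [enc, hk]
    exact hstart _ (Dvd.intro_left j rfl)
  | succ i ih =>
    have hnd : ¬ n ∣ j * n + i + 1 := by
      rw [add_assoc, Nat.dvd_add_right (Dvd.intro_left j rfl)]
      exact Nat.not_dvd_of_pos_of_lt i.succ_pos hi
    rw [← add_assoc, decState, if_neg hnd, ih (by omega), IsStabilizingFeedback.gridState]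
    rfl

theorem isBlockRun (hτ : 0 < τ) {σ : ℝ → Fin N} (hσ : IsSwitchingSignal σ)
    {u : ℝ → EuclideanSpace ℝ (Fin c)} {x : ℝ → EuclideanSpace ℝ (Fin d)}
    (hu : ∀ k : ℕ, EqOn u (P.inp n hφ τ (P.enc n (fun j => x (j * τ)) (fun j => σ (j * τ))) k)
      (Ico ((k : ℝ) * τ) (((k : ℝ) + 1) * τ))) (hx : IsSolution A B σ u x) (j : ℕ) :
    IsBlockRun hφ σ u x τ (j * n) n (P.blockStart n (fun j => x (j * τ)) j) where
  switching := hσ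
  solution := hx
  period_pos := hτ
  input i hi s hs := by
    rw [hu (j * n + i) ⟨by linarith [hs.1], by linarith [hs.2]⟩, inp,
      P.decState_enc n hφ τ _ _ j hi, add_sub_cancel_left]
    rfl

/-- The coder need not know in how many windows σ switched: it measures the state, and the least
sufficient index is no larger than the true count. The cutoff at `n` is then inactive. -/
theorem pick_spec {ρ : ℝ} {y : EuclideanSpace ℝ (Fin d)} {p : ℕ} (hp : p ≤ n)
    (h : ‖y‖ ≤ ρ * P.factor p) :
    ((P.pick n ρ y : Fin (n + 1)) : ℕ) ≤ p ∧ ‖y‖ ≤ ρ * P.factor (P.pick n ρ y) := by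
  have h1 : sInf {p | ‖y‖ ≤ ρ * P.factor p} ≤ p := Nat.sInf_le h
  have h2 : ((P.pick n ρ y : Fin (n + 1)) : ℕ) = sInf {p | ‖y‖ ≤ ρ * P.factor p} :=
    min_eq_left (h1.trans hp)
  rw [h2]
  exact ⟨h1, Nat.sInf_mem (s := {p | ‖y‖ ≤ ρ * P.factor p}) ⟨p, h⟩⟩

end BlockDesign

/-! ### Propagation of the bound from block to block. -/

/-- The factor `exp (μ₁ p) (a + b p)` by which the bound on the state may grow over a block of length
`n τ` with switches in `p` sampling intervals. -/
noncomputable def blockFactor {d c N : ℕ} (A : Fin N → Matrix (Fin d) (Fin d) ℝ)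
    (B : Fin N → Matrix (Fin d) (Fin c) ℝ)
    (φ : EuclideanSpace ℝ (Fin d) → Fin N → EuclideanSpace ℝ (Fin c))
    (D μ₁ μ₂ τ α : ℝ) (n p : ℕ) : ℝ :=
  Real.exp (μ₁ * p) * (D * Real.exp (-μ₂ * (n * τ)) + Real.exp (growthRate A * (n * τ)) * α +
    Real.exp (growthRate A * (n * τ)) * τ * D * (modeSpread A + modeSpread B * feedbackGain φ) * p)

/-- The factor by which the state may exceed the bound inside a block. -/
noncomputable def overshoot {d c N : ℕ} (A : Fin N → Matrix (Fin d) (Fin d) ℝ)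
    (B : Fin N → Matrix (Fin d) (Fin c) ℝ)
    (φ : EuclideanSpace ℝ (Fin d) → Fin N → EuclideanSpace ℝ (Fin c))
    (D μ₁ τ α : ℝ) (n : ℕ) : ℝ :=
  Real.exp (μ₁ * n) * (D + Real.exp (growthRate A * (n * τ)) * α +
    Real.exp (growthRate A * (n * τ)) * τ * D * (modeSpread A + modeSpread B * feedbackGain φ) * n)

namespace BlockDesign

variable {d c N m : ℕ}

/-- The design uses a quantizer of accuracy `α` that annihilates the ball of radius `δ`, and the
factors `blockFactor`. -/
structure IsSound (P : BlockDesign d m) (A : Fin N → Matrix (Fin d) (Fin d) ℝ)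
    (B : Fin N → Matrix (Fin d) (Fin c) ℝ)
    (φ : EuclideanSpace ℝ (Fin d) → Fin N → EuclideanSpace ℝ (Fin c))
    (D μ₁ μ₂ τ α δ : ℝ) (n : ℕ) : Prop where
  norm_point_le : ∀ s, ‖P.point s‖ ≤ 1
  accurate : ∀ y, ‖y‖ ≤ 1 → ‖y - P.point (P.quant y)‖ ≤ α
  point_eq_zero : ∀ y, ‖y‖ ≤ δ → P.point (P.quant y) = 0
  radius_pos : 0 < P.radius
  factor_eq : ∀ p, P.factor p = blockFactor A B φ D μ₁ μ₂ τ α n p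

/-- A trajectory of the closed loop with the coder–controller of the design `P`. -/
structure IsCodedRun (P : BlockDesign d m) (n : ℕ) {A : Fin N → Matrix (Fin d) (Fin d) ℝ}
    {B : Fin N → Matrix (Fin d) (Fin c) ℝ}
    {φ : EuclideanSpace ℝ (Fin d) → Fin N → EuclideanSpace ℝ (Fin c)} {D μ₁ μ₂ : ℝ}
    (hφ : IsStabilizingFeedback A B φ D μ₁ μ₂) (τ : ℝ) (σ : ℝ → Fin N)
    (x : ℝ → EuclideanSpace ℝ (Fin d)) : Prop where
  norm_zero_le : ‖x 0‖ ≤ P.radius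
  switching : IsSwitchingSignal σ
  exists_input : ∃ u : ℝ → EuclideanSpace ℝ (Fin c),
    (∀ k : ℕ, EqOn u (P.inp n hφ τ (P.enc n (fun j => x (j * τ)) (fun j => σ (j * τ))) k)
      (Ico ((k : ℝ) * τ) (((k : ℝ) + 1) * τ))) ∧ IsSolution A B σ u x

variable {A : Fin N → Matrix (Fin d) (Fin d) ℝ} {B : Fin N → Matrix (Fin d) (Fin c) ℝ}
  {φ : EuclideanSpace ℝ (Fin d) → Fin N → EuclideanSpace ℝ (Fin c)} {D μ₁ μ₂ : ℝ}
  {hφ : IsStabilizingFeedback A B φ D μ₁ μ₂} {τ α δ : ℝ} {n : ℕ} {P : BlockDesign d m}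
  {σ : ℝ → Fin N} {x : ℝ → EuclideanSpace ℝ (Fin d)}

theorem norm_blockStart_le (hP : P.IsSound A B φ D μ₁ μ₂ τ α δ n)
    {X : ℕ → EuclideanSpace ℝ (Fin d)} {j : ℕ} (hpos : 0 < P.boundSeq n X (j * n)) :
    ‖P.blockStart n X j‖ ≤ P.boundSeq n X (j * n) := by
  rw [blockStart, norm_smul, Real.norm_of_nonneg hpos.le]
  exact mul_le_of_le_one_right hpos.le (hP.norm_point_le _)

theorem norm_sub_blockStart_le (hP : P.IsSound A B φ D μ₁ μ₂ τ α δ n)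
    {X : ℕ → EuclideanSpace ℝ (Fin d)} {j : ℕ} (hpos : 0 < P.boundSeq n X (j * n))
    (hX : ‖X (j * n)‖ ≤ P.boundSeq n X (j * n)) :
    ‖X (j * n) - P.blockStart n X j‖ ≤ α * P.boundSeq n X (j * n) := by
  set ρ := P.boundSeq n X (j * n) with hρ
  have h1 : ‖ρ⁻¹ • X (j * n)‖ ≤ 1 := by
    rw [norm_smul, norm_inv, Real.norm_of_nonneg hpos.le, inv_mul_le_iff₀ hpos, mul_one]
    exact hX
  have h2 : X (j * n) - P.blockStart n X j =
      ρ • (ρ⁻¹ • X (j * n) - P.point (P.quant (ρ⁻¹ • X (j * n)))) := by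
    rw [smul_sub, smul_inv_smul₀ hpos.ne', blockStart]
  rw [h2, norm_smul, Real.norm_of_nonneg hpos.le, mul_comm]
  exact mul_le_mul_of_nonneg_right (hP.accurate _ h1) hpos.le

theorem blockFactor_pos (hD : 0 ≤ D) (hα : 0 < α) (hτ : 0 < τ) (p : ℕ) :
    0 < blockFactor A B φ D μ₁ μ₂ τ α n p := by
  have := IsBlockRun.spread_nonneg A B φ
  rw [blockFactor]
  positivity

/-- Limits how fast the bound may shrink, which keeps tiny states in the zero cell for many blocks.
-/
theorem le_blockFactor (hD : 0 ≤ D) (hμ₁ : 0 ≤ μ₁) (hα : 0 < α) (hτ : 0 < τ) (p : ℕ) :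
    Real.exp (growthRate A * (n * τ)) * α ≤ blockFactor A B φ D μ₁ μ₂ τ α n p := by
  have hs := IsBlockRun.spread_nonneg A B φ
  have h1 : 1 ≤ Real.exp (μ₁ * p) := Real.one_le_exp (by positivity)
  have h2 : 0 ≤ D * Real.exp (-μ₂ * (n * τ)) := by positivity
  have h3 : 0 ≤ Real.exp (growthRate A * (n * τ)) * τ * D *
    (modeSpread A + modeSpread B * feedbackGain φ) * p := by positivity
  have h4 : 0 ≤ Real.exp (growthRate A * (n * τ)) * α := by positivity
  rw [blockFactor]
  refine le_trans ?_ (le_mul_of_one_le_left (by linarith) h1)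
  linarith

theorem blockFactor_mono (hD : 0 ≤ D) (hμ₁ : 0 ≤ μ₁) (hα : 0 < α) (hτ : 0 < τ) {p q : ℕ}
    (hpq : p ≤ q) : blockFactor A B φ D μ₁ μ₂ τ α n p ≤ blockFactor A B φ D μ₁ μ₂ τ α n q := by
  have hs := IsBlockRun.spread_nonneg A B φ
  have hpq' : (p : ℝ) ≤ q := Nat.cast_le.2 hpq
  rw [blockFactor, blockFactor]
  gcongr


theorem boundSeq_pos (hD : 0 ≤ D) (hτ : 0 < τ) (hα : 0 < α)
    (hP : P.IsSound A B φ D μ₁ μ₂ τ α δ n) (X : ℕ → EuclideanSpace ℝ (Fin d)) (k : ℕ) :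
    0 < P.boundSeq n X k := by
  induction k with
  | zero => exact hP.radius_pos
  | succ k ih =>
    rw [boundSeq]
    split_ifs
    · rw [hP.factor_eq]
      exact mul_pos ih (blockFactor_pos hD hα hτ _)
    · exact ih

theorem radius_mul_pow_le_boundSeq (hD : 0 ≤ D) (hμ₁ : 0 ≤ μ₁) (hτ : 0 < τ) (hα : 0 < α)
    (hn : 0 < n) (hP : P.IsSound A B φ D μ₁ μ₂ τ α δ n) (X : ℕ → EuclideanSpace ℝ (Fin d)) (j : ℕ) :
    P.radius * (Real.exp (growthRate A * (n * τ)) * α) ^ j ≤ P.boundSeq n X (j * n) := by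
  induction j with
  | zero => rw [pow_zero, mul_one, zero_mul, boundSeq]
  | succ j ih =>
    rw [P.boundSeq_block_succ n hn, hP.factor_eq, pow_succ, ← mul_assoc]
    exact mul_le_mul ih (le_blockFactor hD hμ₁ hα hτ _) (by positivity)
      (boundSeq_pos hD hτ hα hP X _).le

theorem norm_sample_succ_le (hD : 0 ≤ D) (hμ₁ : 0 ≤ μ₁) (hμ₂ : 0 ≤ μ₂) (hν : 0 ≤ growthRate A)
    (hτ : 0 < τ) (hα : 0 < α) (hP : P.IsSound A B φ D μ₁ μ₂ τ α δ n)
    (hx : P.IsCodedRun n hφ τ σ x) {j : ℕ}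
    (hj : ‖x ((j * n : ℕ) * τ)‖ ≤ P.boundSeq n (fun k => x (k * τ)) (j * n)) :
    ‖x (((j + 1) * n : ℕ) * τ)‖ ≤ P.boundSeq n (fun k => x (k * τ)) (j * n) *
      P.factor (windowCount σ τ (j * n) n) := by
  obtain ⟨u, hu, hsol⟩ := hx.exists_input
  have hrun := P.isBlockRun n hφ τ hτ hx.switching hu hsol j
  have hpos := boundSeq_pos hD hτ hα hP (fun k => x (k * τ)) (j * n)
  have hz := norm_blockStart_le hP hpos
  have he := norm_sub_blockStart_le hP hpos hj
  have hend := hrun.norm_end_le hD hμ₁ hμ₂ hν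
  rw [Nat.succ_mul, hP.factor_eq]
  set ρ := P.boundSeq n (fun k => x (k * τ)) (j * n) with hρ
  set p := windowCount σ τ (j * n) n with hp
  set z := P.blockStart n (fun k => x (k * τ)) j with hzdef
  have hs := IsBlockRun.spread_nonneg A B φ
  refine hend.trans ?_
  have h1 : D * ‖z‖ * Real.exp (μ₁ * p - μ₂ * (n * τ)) ≤
      D * ρ * (Real.exp (μ₁ * p) * Real.exp (-μ₂ * (n * τ))) := by
    rw [← Real.exp_add, neg_mul, ← sub_eq_add_neg]
    gcongr
  have h2 : IsBlockRun.mismatch A B φ D μ₁ ‖z‖ p ≤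
      (modeSpread A + modeSpread B * feedbackGain φ) * (D * ρ * Real.exp (μ₁ * p)) := by
    rw [IsBlockRun.mismatch]
    gcongr
  -- The quantization error is inflated so that e^{μ₁p} factors out of all three terms.
  have h3 : α * ρ ≤ Real.exp (μ₁ * p) * (α * ρ) :=
    le_mul_of_one_le_left (by positivity) (Real.one_le_exp (by positivity))
  have h4 : ‖x ((j * n : ℕ) * τ) - z‖ + p * τ * IsBlockRun.mismatch A B φ D μ₁ ‖z‖ p ≤
      Real.exp (μ₁ * p) * (α * ρ) + p * τ *
      ((modeSpread A + modeSpread B * feedbackGain φ) * (D * ρ * Real.exp (μ₁ * p))) :=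
    add_le_add (he.trans h3) (mul_le_mul_of_nonneg_left h2 (by positivity))
  refine (add_le_add h1 (mul_le_mul_of_nonneg_left h4 (Real.exp_nonneg _))).trans_eq ?_
  rw [blockFactor]
  ring

theorem norm_le_in_block (hD : 0 ≤ D) (hμ₁ : 0 ≤ μ₁) (hμ₂ : 0 ≤ μ₂) (hν : 0 ≤ growthRate A)
    (hτ : 0 < τ) (hα : 0 < α) (hP : P.IsSound A B φ D μ₁ μ₂ τ α δ n)
    (hx : P.IsCodedRun n hφ τ σ x) {j : ℕ}
    (hj : ‖x ((j * n : ℕ) * τ)‖ ≤ P.boundSeq n (fun k => x (k * τ)) (j * n)) {t : ℝ}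
    (ht : t ∈ Ico ((j * n : ℕ) * τ) ((j * n + n : ℕ) * τ)) :
    ‖x t‖ ≤ P.boundSeq n (fun k => x (k * τ)) (j * n) * overshoot A B φ D μ₁ τ α n := by
  obtain ⟨u, hu, hsol⟩ := hx.exists_input
  have hrun := P.isBlockRun n hφ τ hτ hx.switching hu hsol j
  have hpos := boundSeq_pos hD hτ hα hP (fun k => x (k * τ)) (j * n)
  have hz := norm_blockStart_le hP hpos
  have he := norm_sub_blockStart_le hP hpos hj
  have hin := hrun.norm_le hD hμ₁ hμ₂ hν ht
  set ρ := P.boundSeq n (fun k => x (k * τ)) (j * n) with hρ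
  set p := windowCount σ τ (j * n) n with hp
  set z := P.blockStart n (fun k => x (k * τ)) j with hzdef
  have hs := IsBlockRun.spread_nonneg A B φ
  have hpn : (p : ℝ) ≤ n := Nat.cast_le.2 (windowCount_le τ _ n)
  refine hin.trans ?_
  have h1 : D * ‖z‖ * Real.exp (μ₁ * p) ≤ D * ρ * Real.exp (μ₁ * n) := by gcongr
  have h2 : IsBlockRun.mismatch A B φ D μ₁ ‖z‖ p ≤
      (modeSpread A + modeSpread B * feedbackGain φ) * (D * ρ * Real.exp (μ₁ * n)) := by
    rw [IsBlockRun.mismatch]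
    gcongr
  have h3 : α * ρ ≤ Real.exp (μ₁ * n) * (α * ρ) :=
    le_mul_of_one_le_left (by positivity) (Real.one_le_exp (by positivity))
  have h4 : ‖x ((j * n : ℕ) * τ) - z‖ + p * τ * IsBlockRun.mismatch A B φ D μ₁ ‖z‖ p ≤
      Real.exp (μ₁ * n) * (α * ρ) + n * τ *
      ((modeSpread A + modeSpread B * feedbackGain φ) * (D * ρ * Real.exp (μ₁ * n))) :=
    add_le_add (he.trans h3) (mul_le_mul (by gcongr) h2
      (IsBlockRun.mismatch_nonneg hD (norm_nonneg z) p) (by positivity))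
  refine (add_le_add h1 (mul_le_mul_of_nonneg_left h4 (Real.exp_nonneg _))).trans_eq ?_
  rw [overshoot]
  ring

theorem norm_sample_le (hD : 0 ≤ D) (hμ₁ : 0 ≤ μ₁) (hμ₂ : 0 ≤ μ₂) (hν : 0 ≤ growthRate A)
    (hτ : 0 < τ) (hα : 0 < α) (hn : 0 < n) (hP : P.IsSound A B φ D μ₁ μ₂ τ α δ n)
    (hx : P.IsCodedRun n hφ τ σ x) (j : ℕ) :
    ‖x ((j * n : ℕ) * τ)‖ ≤ P.boundSeq n (fun k => x (k * τ)) (j * n) := by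
  induction j with
  | zero => simpa [boundSeq] using hx.norm_zero_le
  | succ j ih =>
    have h := norm_sample_succ_le hD hμ₁ hμ₂ hν hτ hα hP hx ih
    rw [P.boundSeq_block_succ n hn]
    exact (P.pick_spec n (windowCount_le τ _ n) h).2

theorem boundSeq_le_prod (hD : 0 ≤ D) (hμ₁ : 0 ≤ μ₁) (hμ₂ : 0 ≤ μ₂) (hν : 0 ≤ growthRate A)
    (hτ : 0 < τ) (hα : 0 < α) (hn : 0 < n) (hP : P.IsSound A B φ D μ₁ μ₂ τ α δ n)
    (hx : P.IsCodedRun n hφ τ σ x) (J : ℕ) :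
    P.boundSeq n (fun k => x (k * τ)) (J * n) ≤ P.radius *
      ∏ j ∈ Finset.range J, blockFactor A B φ D μ₁ μ₂ τ α n (windowCount σ τ (j * n) n) := by
  induction J with
  | zero => simp [boundSeq]
  | succ J ih =>
    have h := norm_sample_succ_le hD hμ₁ hμ₂ hν hτ hα hP hx
      (norm_sample_le hD hμ₁ hμ₂ hν hτ hα hn hP hx J)
    have hpick := (P.pick_spec n (windowCount_le τ _ n) h).1
    rw [P.boundSeq_block_succ n hn, hP.factor_eq, Finset.prod_range_succ, ← mul_assoc]
    refine mul_le_mul ih (blockFactor_mono hD hμ₁ hα hτ hpick) (blockFactor_pos hD hα hτ _).le ?_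
    exact mul_nonneg hP.radius_pos.le
      (Finset.prod_nonneg fun j _ => (blockFactor_pos hD hα hτ _).le)

/-- As long as the normalized state is small, nothing is transmitted and the state grows at most with
the rate `growthRate A`. -/
theorem norm_le_exp_of_small (hD : 0 ≤ D) (hμ₁ : 0 ≤ μ₁) (hμ₂ : 0 ≤ μ₂) (hν : 0 ≤ growthRate A)
    (hτ : 0 < τ) (hα : 0 < α) (hα1 : α ≤ 1) (hn : 0 < n) (hP : P.IsSound A B φ D μ₁ μ₂ τ α δ n)
    (hx : P.IsCodedRun n hφ τ σ x) {J : ℕ} (hδ : 0 ≤ δ)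
    (hsmall : ‖x 0‖ ≤ δ * P.radius * α ^ J) {t : ℝ}
    (ht : t ∈ Icc ((J * n : ℕ) * τ) ((J * n + n : ℕ) * τ)) :
    ‖x t‖ ≤ Real.exp (growthRate A * t) * ‖x 0‖ := by
  obtain ⟨u, hu, hsol⟩ := hx.exists_input
  have hstep : ∀ j ≤ J, ‖x ((j * n : ℕ) * τ)‖ ≤
      Real.exp (growthRate A * ((j * n : ℕ) * τ)) * ‖x 0‖ →
      ∀ t ∈ Icc (((j * n : ℕ) : ℝ) * τ) ((j * n + n : ℕ) * τ),
        ‖x t‖ ≤ Real.exp (growthRate A * t) * ‖x 0‖ := by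
    intro j hj hxj t ht
    have hrun := P.isBlockRun n hφ τ hτ hx.switching hu hsol j
    have hpos := boundSeq_pos hD hτ hα hP (fun k => x (k * τ)) (j * n)
    have hlow := radius_mul_pow_le_boundSeq hD hμ₁ hτ hα hn hP (fun k => x (k * τ)) j
    have hz : P.blockStart n (fun k => x (k * τ)) j = 0 := by
      rw [blockStart, hP.point_eq_zero, smul_zero]
      rw [norm_smul, norm_inv, Real.norm_of_nonneg hpos.le, inv_mul_le_iff₀ hpos]
      refine hxj.trans ?_
      have hpow : α ^ J ≤ α ^ j := pow_le_pow_of_le_one hα.le hα1 hj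
      have hexp : Real.exp (growthRate A * ((j * n : ℕ) * τ)) =
          Real.exp (growthRate A * (n * τ)) ^ j := by
        rw [← Real.exp_nat_mul]; congr 1; push_cast; ring
      -- The state grows by at most e^{νT} per block and the bound is multiplied by at least
      -- e^{νT}α, so their ratio grows by at most 1/α. The initial factor α^J pays for J blocks.
      calc Real.exp (growthRate A * ((j * n : ℕ) * τ)) * ‖x 0‖
          ≤ Real.exp (growthRate A * (n * τ)) ^ j * (δ * P.radius * α ^ j) := by
            rw [hexp]
            have := hP.radius_pos
            refine mul_le_mul_of_nonneg_left (hsmall.trans ?_) (by positivity)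
            gcongr
        _ = P.radius * (Real.exp (growthRate A * (n * τ)) * α) ^ j * δ := by
            rw [mul_pow]; ring
        _ ≤ P.boundSeq n (fun k => x (k * τ)) (j * n) * δ :=
            mul_le_mul_of_nonneg_right hlow hδ
    rw [hz] at hrun
    refine (hrun.norm_le_of_zero hD hμ₁ hμ₂ hν ht).trans ?_
    refine (mul_le_mul_of_nonneg_left hxj (Real.exp_nonneg _)).trans_eq ?_
    rw [← mul_assoc, ← Real.exp_add]
    congr 2
    ring
  have hsamples : ∀ j ≤ J, ‖x ((j * n : ℕ) * τ)‖ ≤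
      Real.exp (growthRate A * ((j * n : ℕ) * τ)) * ‖x 0‖ := by
    intro j
    induction j with
    | zero => intro _; simp
    | succ j ih =>
      intro hj
      rw [Nat.succ_mul]
      refine hstep j (Nat.le_of_succ_le hj) (ih (Nat.le_of_succ_le hj)) _ ⟨?_, le_rfl⟩
      push_cast
      nlinarith [Nat.cast_nonneg (α := ℝ) n]
  exact hstep J le_rfl (hsamples J le_rfl) t ht

end BlockDesign

/-! ### Stabilization and the final assembly. -/

section design

variable {d c N : ℕ} {A : Fin N → Matrix (Fin d) (Fin d) ℝ} {B : Fin N → Matrix (Fin d) (Fin c) ℝ}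
  {φ : EuclideanSpace ℝ (Fin d) → Fin N → EuclideanSpace ℝ (Fin c)} {D μ₁ μ₂ : ℝ}

namespace BlockDesign

theorem exists_isSound (m : ℕ) {τ α r : ℝ} (n : ℕ) (hr : 0 < r)
    (hm : Real.sqrt d ≤ α * (2 * m + 1)) :
    ∃ (P : BlockDesign d m) (δ : ℝ), 0 < δ ∧ P.radius = r ∧
      P.IsSound A B φ D μ₁ μ₂ τ α δ n := by
  obtain ⟨q, ctr, h1, h2, δ, hδ, h3⟩ := exists_quantizer d m hm
  exact ⟨⟨q, ctr, blockFactor A B φ D μ₁ μ₂ τ α n, r⟩, δ, hδ, rfl, h1, h2, h3, hr, fun _ => rfl⟩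

/-- The coder–controller of a block design. -/
noncomputable def toCoderController {m : ℕ} (P : BlockDesign d m) (n : ℕ)
    (hφ : IsStabilizingFeedback A B φ D μ₁ μ₂) {τ : ℝ} (hτ : 0 ≤ τ) : CoderController d c N τ :=
  blockCoderController n 0 (P.enc n) (P.enc_trivial n) (P.inp n hφ τ) (P.integrableOn_inp n hφ τ hτ)

theorem isCodedRun_of_isTrajectory {m : ℕ} {P : BlockDesign d m} {n : ℕ}
    {hφ : IsStabilizingFeedback A B φ D μ₁ μ₂} {τ : ℝ} {hτ : 0 ≤ τ} {σ : ℝ → Fin N}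
    {x : ℝ → EuclideanSpace ℝ (Fin d)} (hσ : IsSwitchingSignal σ) (hx0 : ‖x 0‖ ≤ P.radius)
    (hx : (P.toCoderController n hφ hτ).IsTrajectory A B σ x) : P.IsCodedRun n hφ τ σ x where
  norm_zero_le := hx0
  switching := hσ
  exists_input := exists_input_of_isTrajectory_block (P.enc_congr n) (P.inp_congr n hφ τ) hx

theorem stabilizes_toCoderController {m : ℕ} {P : BlockDesign d m} {n : ℕ}
    {hφ : IsStabilizingFeedback A B φ D μ₁ μ₂} {τ α δ τa : ℝ}
    {K : Set (EuclideanSpace ℝ (Fin d))} (hτa : 0 < τa) (hD : 0 ≤ D) (hμ₁ : 0 < μ₁) (hμ₂ : 0 < μ₂)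
    (hν : 0 ≤ growthRate A) (hpar : AdmissibleParameters A B φ D μ₁ μ₂ τa τ α n) (hδ : 0 < δ)
    (hP : P.IsSound A B φ D μ₁ μ₂ τ α δ n) (hK : ∀ y ∈ K, ‖y‖ ≤ P.radius) :
    Stabilizes (P.toCoderController n hφ hpar.period_pos.le) A B K τa := by
  obtain ⟨hτ, hα, hn, hlt⟩ := hpar
  have hn0 : (0 : ℝ) < n := Nat.cast_pos.2 hn
  have hs := IsBlockRun.spread_nonneg A B φ
  set T : ℝ := n * τ with hT
  have hT0 : 0 < T := by positivity
  -- The number of switches per block allowed on average; `a + b * s` is the left side of (*).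
  set s : ℝ := T / τa with hsdef
  have hs0 : 0 < s := by positivity
  set a : ℝ := D * Real.exp (-μ₂ * T) + Real.exp (growthRate A * T) * α with ha
  set b : ℝ := Real.exp (growthRate A * T) * τ * D *
    (modeSpread A + modeSpread B * feedbackGain φ) with hb
  have ha0 : 0 < a := by positivity
  have hb0 : 0 ≤ b := by positivity
  have hab0 : 0 < a + b * s := by positivity
  have hab : a + b * s < Real.exp (-(μ₁ * s)) := by
    have e : -μ₁ * T / τa = -(μ₁ * s) := by rw [hsdef]; ring
    rw [e] at hlt
    refine lt_of_eq_of_lt ?_ hlt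
    rw [ha, hb]; ring
  set q : ℝ := Real.exp (μ₁ * s) * (a + b * s) with hq
  have hq0 : 0 < q := by positivity
  have hq1 : q < 1 := by
    have := mul_lt_mul_of_pos_left hab (Real.exp_pos (μ₁ * s))
    rwa [← Real.exp_add, add_neg_cancel, Real.exp_zero] at this
  have hα1 : α < 1 := by
    have h1 : 1 ≤ Real.exp (growthRate A * T) := Real.one_le_exp (by positivity)
    have h2 : Real.exp (-(μ₁ * s)) ≤ 1 := Real.exp_le_one_iff.2 (by simp; positivity)
    have h3 : 0 ≤ D * Real.exp (-μ₂ * T) := by positivity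
    have h4 : 0 ≤ b * s := by positivity
    have h5 : α ≤ Real.exp (growthRate A * T) * α := le_mul_of_one_le_left hα.le h1
    rw [ha] at hab
    linarith
  -- Thus q = e^{-2λT}: half of the decay is kept, the other half is spent on the class-K function.
  set lam : ℝ := -Real.log q / (2 * T) with hlam
  have hlam0 : 0 < lam := div_pos (neg_pos.2 (Real.log_neg hq0 hq1)) (by positivity)
  refine ⟨lam, hlam0, fun N₀ hN₀ => ?_⟩
  -- The factor q⁻¹ compensates for times inside a block, where t < (J + 1)T. `N₀` enters here only.
  set C : ℝ := P.radius * Real.exp ((μ₁ + b / (a + b * s)) * (N₀ + 1)) *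
    overshoot A B φ D μ₁ τ α n * q⁻¹ with hC
  have hover : 0 < overshoot A B φ D μ₁ τ α n := by
    rw [overshoot]
    positivity
  have hrad := hP.radius_pos
  have hC0 : 0 < C := by positivity
  obtain ⟨g, hg, hbound⟩ := exists_isClassK_of_exp_bounds hν hlam0 (mul_pos hδ hrad) hα hα1 hT0 hC0
  refine ⟨g, hg, fun σ hσ hadt x hxK hx t ht => ?_⟩
  have hrun := isCodedRun_of_isTrajectory hσ (hK _ hxK) hx
  obtain ⟨J, hJ⟩ : ∃ J, J = ⌊t / T⌋₊ := ⟨_, rfl⟩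
  have hmem := mem_Ico_floor_div hT0 ht
  rw [← hJ] at hmem
  have hblock : t ∈ Ico (((J * n : ℕ) : ℝ) * τ) ((J * n + n : ℕ) * τ) := by
    have e1 : ((J * n : ℕ) : ℝ) * τ = J * T := by rw [hT]; push_cast; ring
    have e2 : ((J * n + n : ℕ) : ℝ) * τ = (J + 1) * T := by rw [hT]; push_cast; ring
    rw [e1, e2]
    exact hmem
  refine hbound ‖x 0‖₊ t ‖x t‖ ht (norm_nonneg _) ?_ fun hsmall => ?_
  · have hcount : ((∑ j ∈ Finset.range J, windowCount σ τ (j * n) n : ℕ) : ℝ) ≤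
        (N₀ + 1) + J * s := by
      rw [sum_windowCount]
      -- Prolonging the interval by τa costs exactly one more allowed switch, hence N₀ + 1.
      have h1 : (windowCount σ τ 0 (J * n) : ℝ) ≤ numSwitches σ ((J * n : ℕ) * τ + τa) 0 :=
        Nat.cast_le.2 (hσ.windowCount_le_numSwitches hτ hτa (J * n))
      refine (h1.trans (hadt 0 _ le_rfl (by positivity))).trans_eq ?_
      rw [hsdef, hT]
      push_cast
      field_simp
      ring
    have hprod := prod_exp_mul_affine_le ha0 hb0 hμ₁.le hs0.le
      (fun j => windowCount σ τ (j * n) n) J hcount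
    have h1 := boundSeq_le_prod hD hμ₁.le hμ₂.le hν hτ hα hn hP hrun J
    have h2 := norm_le_in_block hD hμ₁.le hμ₂.le hν hτ hα hP hrun
      (norm_sample_le hD hμ₁.le hμ₂.le hν hτ hα hn hP hrun J) hblock
    have h3 : q ^ J ≤ q⁻¹ * Real.exp (-(2 * lam) * t) := by
      have e1 : -(2 * lam) = Real.log q / T := by rw [hlam]; field_simp
      rw [← div_eq_inv_mul, le_div_iff₀ hq0, ← pow_succ, ← Real.rpow_natCast,
        Real.rpow_def_of_pos hq0, Real.exp_le_exp, e1]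
      have h4 : t / T ≤ ((J + 1 : ℕ) : ℝ) := by
        rw [div_le_iff₀ hT0]; push_cast; exact hmem.2.le
      have h5 := mul_le_mul_of_nonpos_left h4 (Real.log_neg hq0 hq1).le
      refine h5.trans_eq ?_
      ring
    calc ‖x t‖ ≤ P.boundSeq n (fun k => x (k * τ)) (J * n) * overshoot A B φ D μ₁ τ α n := h2
      _ ≤ (P.radius * (Real.exp ((μ₁ + b / (a + b * s)) * (N₀ + 1)) * q ^ J)) *
          overshoot A B φ D μ₁ τ α n := by
        refine mul_le_mul_of_nonneg_right (h1.trans ?_) hover.le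
        exact mul_le_mul_of_nonneg_left hprod hrad.le
      _ ≤ (P.radius * (Real.exp ((μ₁ + b / (a + b * s)) * (N₀ + 1)) *
          (q⁻¹ * Real.exp (-(2 * lam) * t)))) * overshoot A B φ D μ₁ τ α n := by gcongr
      _ = C * Real.exp (-(2 * lam) * t) := by rw [hC]; ring
  · rw [← hJ, coe_nnnorm] at hsmall
    exact norm_le_exp_of_small hD hμ₁.le hμ₂.le hν hτ hα hα1.le hn hP hrun hδ.le hsmall
      ⟨hblock.1, hblock.2.le⟩

end BlockDesign

/-- If all modes are uniformly contracting, no control is needed. -/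
theorem stabilizes_of_growthRate_neg {τ τa : ℝ} {n : ℕ} {Q : Type} [Finite Q] {q₀ : Q}
    {K : Set (EuclideanSpace ℝ (Fin d))} (hν : growthRate A < 0) (hN : 0 < N)
    (hτ : 0 < τ)
    {henc : ∀ (_ : ℕ → EuclideanSpace ℝ (Fin d)) (_ : ℕ → Fin N) (k : ℕ),
      n ∣ k ∨ ((⟨0, hN⟩ : Fin N), q₀).2 = q₀}
    {hinp : ∀ (_ : ℕ → Fin N × Q) (k : ℕ), IntegrableOn (fun _ => (0 : EuclideanSpace ℝ (Fin c)))
      (Ico ((k : ℝ) * τ) (((k : ℝ) + 1) * τ)) volume} :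
    Stabilizes (blockCoderController (τs := τ) n q₀ (fun _ _ _ => (⟨0, hN⟩, q₀)) henc
      (fun _ _ _ => 0) hinp) A B K τa := by
  refine ⟨-growthRate A, neg_pos.2 hν, fun N₀ _ => ⟨id, ⟨strictMono_id, continuous_id, rfl⟩,
    fun σ _ _ x _ hx t ht => ?_⟩⟩
  obtain ⟨u, hu, hsol⟩ := exists_input_of_isTrajectory_block (fun _ _ _ _ _ _ _ => rfl)
    (fun _ _ _ _ => rfl) hx
  have hu0 : ∀ r, 0 ≤ r → u r = 0 := fun r hr => hu _ (mem_Ico_floor_div hτ hr)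
  -- Comparison with the zero solution has no mismatch at all, so `W` = 0 and the negative rate is
  -- admitted.
  have h := hsol.norm_sub_le (T₀ := 0) (τ := t) (W := 0)
    (IsSolution.zero_solution ⟨0, hN⟩) le_rfl
    (fun r hr => hu0 _ (by linarith [hr.1])) (Or.inr rfl) le_rfl
    (fun r _ => Or.inr (by simp)) t ⟨ht, le_rfl⟩
  simp only [zero_add, sub_zero, mul_zero, add_zero] at h
  rw [neg_neg, mul_comm]
  exact h

/-- Rounding to the nearest integer m gives √d/(2α) ≤ m + 1/2, which is precisely the accuracy
condition of the quantizer. -/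
theorem quantizerSize_eq (d : ℕ) {α : ℝ} (hα : 0 < α) : ∃ m : ℕ,
    Real.sqrt d ≤ α * (2 * m + 1) ∧ quantizerSize d α = ((2 * m + 1) ^ d : ℕ) := by
  obtain ⟨r, hr⟩ : ∃ r, r = round (Real.sqrt d / (2 * α)) := ⟨_, rfl⟩
  have h0 : 0 ≤ Real.sqrt d / (2 * α) := by positivity
  have h1 := abs_le.1 (abs_sub_round (Real.sqrt d / (2 * α)))
  rw [← hr] at h1
  have hr0 : 0 ≤ r := by
    have : (-1 : ℝ) < r := by linarith
    have : (-1 : ℤ) < r := by exact_mod_cast this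
    omega
  obtain ⟨m, rfl⟩ := Int.eq_ofNat_of_zero_le hr0
  refine ⟨m, ?_, ?_⟩
  · have h2 : Real.sqrt d / (2 * α) ≤ m + 1 / 2 := by
      have := h1.2
      push_cast at this
      linarith
    rw [div_le_iff₀ (by positivity)] at h2
    linarith
  · rw [quantizerSize, ← hr]
    push_cast
    ring

theorem exists_stabilizing_coderController {K : Set (EuclideanSpace ℝ (Fin d))} {τs α τa : ℝ}
    {n : ℕ} (hN : 0 < N) (hK : IsCompact K) (hτa : 0 < τa) (hD : 0 ≤ D) (hμ₁ : 0 < μ₁)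
    (hμ₂ : 0 < μ₂) (hφ : IsStabilizingFeedback A B φ D μ₁ μ₂)
    (hpar : AdmissibleParameters A B φ D μ₁ μ₂ τa τs α n) :
    ∃ C : CoderController d c N τs,
      C.dataRate = (designRate d N τs α n : EReal) ∧ Stabilizes C A B K τa := by
  obtain ⟨m, hm, hsize⟩ := quantizerSize_eq d hpar.accuracy_pos
  -- The rate depends only on the alphabets, so this serves both signs of the growth rate.
  have hrate : ∀ C : CoderController d c N τs, C.Alphabet =
      BlockAlphabet N n (0 : BlockMessage d m n) →
      C.dataRate = (designRate d N τs α n : EReal) := by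
    intro C hC
    rw [dataRate_eq_of_card (n := n) (M := (2 * m + 1) ^ d * (n + 1)) hN hpar.one_le
      (by positivity)]
    · rw [designRate, hsize, Nat.cast_mul, Real.logb_mul (by positivity) (by positivity)]
      refine congrArg Real.toEReal ?_
      push_cast
      ring
    · intro k
      rw [hC, nat_card_blockAlphabet]
      simp [BlockMessage]
  rcases lt_or_ge (growthRate A) 0 with hν | hν
  · exact ⟨_, hrate _ rfl, stabilizes_of_growthRate_neg (q₀ := (0 : BlockMessage d m n)) (n := n)
      (henc := fun _ _ _ => Or.inr rfl) (hinp := fun _ _ => integrableOn_zero) hν hN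
      hpar.period_pos⟩
  · obtain ⟨r, hr⟩ := hK.isBounded.exists_norm_le
    obtain ⟨P, δ, hδ, hrad, hP⟩ := BlockDesign.exists_isSound (A := A) (B := B) (φ := φ) (D := D)
      -- The maximum with 1 makes the initial bound positive, since the coder divides by it.
      (μ₁ := μ₁) (μ₂ := μ₂) (τ := τs) m n (r := max r 1) (by positivity) hm
    exact ⟨P.toCoderController n hφ hpar.period_pos.le, hrate _ rfl,
      P.stabilizes_toCoderController hτa hD hμ₁ hμ₂ hν hpar hδ hP
        fun y hy => (hr y hy).trans (hrad ▸ le_max_left _ _)⟩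

end design

theorem theorem1 {d c N : ℕ} (hN : 0 < N)
    (A : Fin N → Matrix (Fin d) (Fin d) ℝ) (B : Fin N → Matrix (Fin d) (Fin c) ℝ)
    (K : Set (EuclideanSpace ℝ (Fin d))) (hK : IsCompact K) (hK0 : 0 ∈ interior K)
    (τa : ℝ) (hτa : 0 < τa)
    (φ : EuclideanSpace ℝ (Fin d) → Fin N → EuclideanSpace ℝ (Fin c))
    (D μ₁ μ₂ : ℝ) (hD : 0 ≤ D) (hμ₁ : 0 < μ₁) (hμ₂ : 0 < μ₂) (hμ : μ₁ / τa < μ₂)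
    (hφ : IsStabilizingFeedback A B φ D μ₁ μ₂) :
    -- some coder–controller with finite data rate stabilizes the system
    (∃ τs : ℝ, 0 < τs ∧ ∃ C : CoderController d c N τs,
      C.dataRate < ⊤ ∧ Stabilizes C A B K τa) ∧
    -- admissible design parameters exist
    (∃ (τs α : ℝ) (n : ℕ), AdmissibleParameters A B φ D μ₁ μ₂ τa τs α n) ∧
    -- for all of them the stabilization is achieved at the explicit data rate
    (∀ (τs α : ℝ) (n : ℕ), AdmissibleParameters A B φ D μ₁ μ₂ τa τs α n →
      ∃ C : CoderController d c N τs,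
        C.dataRate = (designRate d N τs α n : EReal) ∧ Stabilizes C A B K τa) := by
  have hpar := exists_admissibleParameters A B φ (D := D) (μ₁ := μ₁) (μ₂ := μ₂) hτa hμ
  refine ⟨?_, hpar, fun τs α n h =>
    exists_stabilizing_coderController hN hK hτa hD hμ₁ hμ₂ hφ h⟩
  obtain ⟨τs, α, n, h⟩ := hpar
  obtain ⟨C, hC, hstab⟩ := exists_stabilizing_coderController (K := K) hN hK hτa hD hμ₁ hμ₂ hφ h
  exact ⟨τs, h.period_pos, C, hC ▸ EReal.coe_lt_top _, hstab⟩
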